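/- **Setting.** Let $n\ge 2$, $N\ge 1$, let $X\subset\mathbb R^n$ be compact, $y_1,\dots,y_N\in\mathbb R^n$, $Y=\{y_1,\dots,y_N\}$, and let $\mu$ be a Borel probability measure with $\operatorname{spt}\mu\subset X$, absolutely continuous with respect to Lebesgue measure. Let the cost $c$ satisfy - (Reg): $c(\cdot,y_i)\in C^2(X)$ for every $i$ (i.e. $c(\cdot,y_i)$ is $C^2$ on an open neighbourhood of $X$); - (Twist): $\nabla_xc(x,y_i)\ne\nabla_xc(x,y_k)$ for all $x\in X$ and $i\neq k$. For $\psi\in\mathbb R^N$ put $$\mathrm{Lag}_i(\psi)=\{x\in X:\ -c(x,y_i)-\psi^i=\max_k(-c(x,y_k)-\psi^k)\},\qquad G^i(\psi)=\mu(\mathrm{Lag}_i(\psi)),$$ $\mathcal K^\varepsilon=\{\psi:\ G^i(\psi)>\varepsilon\ \forall i\}$, and, for $h,\varepsilon>0$, $$w^i_{h,\varepsilon}(\psi)=(G^i(\psi)-\varepsilon)\,g(\psi^i/h),\qquad g(t)=2\bigl(1+t^2-t\sqrt{1+t^2}\bigr).$$ For $w\in\mathbb R^N$ with $w^i\ge0$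 let $F_w(\lambda)=0$ if $\lambda\in\prod_i[0,w^i]$ and $F_w(\lambda)=+\infty$ otherwise. A pair $(T,\lambda)$ is a minimizer with storage fee $F_w$ if it minimizes $\int_Xc(x,T(x))\,d\mu+F_w(\lambda)$ among all pairs of a measurable $T:X\to Y$ and a $\lambda\in\mathbb R^N$ with $T_\#\mu=\sum_i\lambda^i\delta_{y_i}$. Write $\|v\|_1=\sum_i|v^i|$ and $\Delta_\mu(A,B)=\mu((A\setminus B)\cup(B\setminus A))$. For a constant $C_L>0$ let $(\mathrm E_{C_L})$ be the following assertion: for all $h>0$, $\varepsilon\in(0,\frac1{2N})$, all $w\in[0,1]^N$ with $\sum_iw^i\ge1$, all $\psi\in\mathcal K^\varepsilon$ and every minimizer $(T,\lambda)$ with storage fee $F_w$, $$\|G(\psi)-\lambda\|_1\le 2\bigl(N\varepsilon+\|w_{h,\varepsilon}(\psi)-w\|_1+2N\sqrt{2C_Lh}\bigr)$$ and $$\sum_{i=1}^N\Delta_\mu\bigl(\mathrm{Lag}_i(\psi),T^{-1}(\{y_i\})\bigr)\le 8N\bigl(N\varepsilon+\|w_{h,\varepsilon}(\psi)-w\|_1+2N\sqrt{2C_Lh}\bigr).$$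 **Theorem.** 1. For all $M,A,B,\tau>0$ there is a constant $C_L>0$, depending only on $n,N,M,A,B,\tau$, such that for all data as in the setting for which $\mu$ has a density bounded by $M$, $\mathcal H^{n-1}(\partial X)\le A$, the derivatives of $c(\cdot,y_i)$ of orders $0,1,2$ are bounded by $B$ on $X$ for every $i$, and $\|\nabla_xc(x,y_i)-\nabla_xc(x,y_k)\|\ge\tau$ for all $x\in X$, $i\ne k$: the map $G:\mathbb R^N\to\mathbb R^N$ is Lipschitz with constant $C_LN$ for the Euclidean norm, and $(\mathrm E_{C_L})$ holds. 2. For every $\Lambda>0$ there is a constant $C_L>0$, depending only on $n,N,\Lambda$, such that $(\mathrm E_{C_L})$ holds for all data as in the setting for which $G$ is Lipschitz on $\mathbb R^N$ with constant $\Lambda N$ for the Euclidean norm. -/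

import Mathlib

open MeasureTheory

noncomputable section

namespace StorageOT

/-- Euclidean space of dimension `n`, with the Euclidean norm. -/
abbrev Euc (n : ℕ) : Type := EuclideanSpace ℝ (Fin n)

/-- (Reg): each `c(·, y_i)` is of class `C²` on the compact set `X`, that is, it is (the
restriction to `X` of) a function which is `C²` on an open neighbourhood of `X`. The function
`c (·) (y i)` itself is taken to be such an extension, so that its gradient makes sense at every
point of `X`. -/
def Reg {n N : ℕ} (X : Set (Euc n)) (y : Fin N → Euc n) (c : Euc n → Euc n → ℝ) : Prop :=
  ∀ i, ∃ U : Set (Euc n), IsOpen U ∧ X ⊆ U ∧ ContDiffOn ℝ 2 (fun x => c x (y i)) U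

/-- (Twist): `∇ₓ c(x, y_i) ≠ ∇ₓ c(x, y_k)` for all `x ∈ X` and `i ≠ k`. -/
def Twist {n N : ℕ} (X : Set (Euc n)) (y : Fin N → Euc n) (c : Euc n → Euc n → ℝ) : Prop :=
  ∀ x ∈ X, ∀ i k, i ≠ k →
    gradient (fun z => c z (y i)) x ≠ gradient (fun z => c z (y k)) x

/-- The setting: `X` is compact, `μ` (a probability measure) is carried by `X` and absolutely
continuous with respect to Lebesgue measure, and the cost satisfies (Reg) and (Twist). -/
structure Setting {n N : ℕ} (X : Set (Euc n)) (y : Fin N → Euc n) (c : Euc n → Euc n → ℝ)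
    (μ : Measure (Euc n)) : Prop where
  compact : IsCompact X
  prob : IsProbabilityMeasure μ
  support : μ Xᶜ = 0
  absCont : μ ≪ volume
  reg : Reg X y c
  twist : Twist X y c

/-- The `c*`-transform `ψ^{c*}(x) = max_i (-c(x, y_i) - ψ^i)`. -/
def cStar {n N : ℕ} (y : Fin N → Euc n) (c : Euc n → Euc n → ℝ) (ψ : Euc N) (x : Euc n) : ℝ :=
  ⨆ i, (-c x (y i) - ψ i)

/-- The Laguerre cell `Lag_i(ψ)`. -/
def Lag {n N : ℕ} (X : Set (Euc n)) (y : Fin N → Euc n) (c : Euc n → Euc n → ℝ)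
    (ψ : Euc N) (i : Fin N) : Set (Euc n) :=
  {x | x ∈ X ∧ -c x (y i) - ψ i = cStar y c ψ x}

/-- The vector `G(ψ)` of the `μ`-masses of the Laguerre cells. -/
def G {n N : ℕ} (X : Set (Euc n)) (y : Fin N → Euc n) (c : Euc n → Euc n → ℝ)
    (μ : Measure (Euc n)) (ψ : Euc N) : Euc N :=
  WithLp.toLp 2 fun i => μ.real (Lag X y c ψ i)

/-- `𝒦^ε`: the vectors `ψ` all of whose Laguerre cells have mass larger than `ε`. -/
def K {n N : ℕ} (X : Set (Euc n)) (y : Fin N → Euc n) (c : Euc n → Euc n → ℝ)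
    (μ : Measure (Euc n)) (ε : ℝ) : Set (Euc N) :=
  {ψ | ∀ i, ε < G X y c μ ψ i}

/-- `g(t) = 2 (1 + t² - t √(1 + t²))`. -/
def g (t : ℝ) : ℝ := 2 * (1 + t ^ 2 - t * Real.sqrt (1 + t ^ 2))

/-- `w_{h,ε}(ψ)`, with components `(G^i(ψ) - ε) g(ψ^i / h)`. -/
def wMap {n N : ℕ} (X : Set (Euc n)) (y : Fin N → Euc n) (c : Euc n → Euc n → ℝ)
    (μ : Measure (Euc n)) (h ε : ℝ) (ψ : Euc N) : Euc N :=
  WithLp.toLp 2 fun i => (G X y c μ ψ i - ε) * g (ψ i / h)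

/-- The `ℓ¹` norm. -/
def norm1 {N : ℕ} (v : Euc N) : ℝ := ∑ i, |v i|

open Classical in
/-- The hard capacity storage fee `F_w`: zero on `∏ [0, w^i]`, and `+∞` elsewhere. -/
def capFee {N : ℕ} (w lam : Euc N) : EReal :=
  if ∀ i, 0 ≤ lam i ∧ lam i ≤ w i then 0 else ⊤

/-- `(T, λ)` is a competitor: `T : X → Y` is measurable and `T_# μ = ∑ λ^i δ_{y_i}`. Only the
values of `T` on `X` matter. -/
structure IsCompetitor {n N : ℕ} (X : Set (Euc n)) (y : Fin N → Euc n) (μ : Measure (Euc n))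
    (T : Euc n → Euc n) (lam : Euc N) : Prop where
  measurable : Measurable T
  mapsTo : ∀ x ∈ X, T x ∈ Set.range y
  nonneg : ∀ i, 0 ≤ lam i
  map_eq : μ.map T = ∑ i, ENNReal.ofReal (lam i) • Measure.dirac (y i)

/-- The total cost `∫_X c(x, T(x)) dμ + F(λ)`. -/
def totalCost {n N : ℕ} (X : Set (Euc n)) (c : Euc n → Euc n → ℝ) (μ : Measure (Euc n))
    (F : Euc N → EReal) (T : Euc n → Euc n) (lam : Euc N) : EReal :=
  ((∫ x in X, c x (T x) ∂μ : ℝ) : EReal) + F lam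

/-- `(T, λ)` minimizes the transport problem with storage fee `F`. -/
structure IsMinimizer {n N : ℕ} (X : Set (Euc n)) (y : Fin N → Euc n) (c : Euc n → Euc n → ℝ)
    (μ : Measure (Euc n)) (F : Euc N → EReal) (T : Euc n → Euc n) (lam : Euc N) : Prop where
  competitor : IsCompetitor X y μ T lam
  le : ∀ (T' : Euc n → Euc n) (lam' : Euc N), IsCompetitor X y μ T' lam' →
    totalCost X c μ F T lam ≤ totalCost X c μ F T' lam'

/-- The `μ`-symmetric distance `Δ_μ(A, B) = μ((A \ B) ∪ (B \ A))`. -/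
def symmDist {n : ℕ} (μ : Measure (Euc n)) (A B : Set (Euc n)) : ℝ :=
  μ.real ((A \ B) ∪ (B \ A))

/-- The map `G` is Lipschitz on `ℝ^N`, for the Euclidean norms, with constant `C`. -/
def GLipschitz {n N : ℕ} (X : Set (Euc n)) (y : Fin N → Euc n) (c : Euc n → Euc n → ℝ)
    (μ : Measure (Euc n)) (C : ℝ) : Prop :=
  ∀ ψ φ : Euc N, ‖G X y c μ ψ - G X y c μ φ‖ ≤ C * ‖ψ - φ‖

/-- Quantitative bounds on the data: the density of `μ` is at most `M`, the boundary of `X` has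
`(n-1)`-dimensional Hausdorff measure at most `A`, the costs have `C²` norms at most `B` on `X`,
and their gradients are separated by at least `τ`. -/
structure DataBounds {n N : ℕ} (X : Set (Euc n)) (y : Fin N → Euc n) (c : Euc n → Euc n → ℝ)
    (μ : Measure (Euc n)) (M A B τ : ℝ) : Prop where
  density : μ ≤ ENNReal.ofReal M • (volume : Measure (Euc n))
  boundary : Measure.hausdorffMeasure ((n : ℝ) - 1) (frontier X) ≤ ENNReal.ofReal A
  costC2 : ∀ i, ∀ x ∈ X, ∀ m : ℕ, m ≤ 2 →
    ‖iteratedFDeriv ℝ m (fun z => c z (y i)) x‖ ≤ B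
  twist : ∀ x ∈ X, ∀ i k, i ≠ k →
    τ ≤ ‖gradient (fun z => c z (y i)) x - gradient (fun z => c z (y k)) x‖

end StorageOT

end

/-! Transport with capacities `w` has a dual solution: prices `φ ≥ 0` with `G φ ≤ w`, and equality
in each coordinate where `φ` is positive (`exists_price`). By complementary slackness every
minimizer sends almost every point to the target of a cell of `φ` containing it
(`ae_mem_Lag_of_isMinimizer`). Both estimates therefore compare the cells of `ψ` with those of `φ`.

Mass passes from cell `i` of `ψ` to another cell `k` of `φ` only if `ψ i - φ i < ψ k - φ k`, because
ties are level sets of functions with nonvanishing gradient, hence null. For a flow that only climbs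
in this order, the inflow into one cell is bounded by the total change of masses
(`sum_flow_into_le`), which reduces the symmetric differences to the masses. There is also a
comparison principle (`sum_max_sub_le_of_flow`): bounding the loss of mass where `ψ < φ` and the
gain where `ψ > φ` controls the whole change.

These one-sided bounds come from `g`. Always `g ≥ 1`; moreover `g (ψ i / h) ≤ 1 + h` if `ψ i ≥ √h`,
and `g (ψ i / h) ≥ 1 / h` if `ψ i ≤ -√h`. The window `|ψ i| < √h` is removed by shrinking the prices
by `√h`, which changes `G` by `O(√h)` since `G` is Lipschitz.

The Lipschitz bound of the first statement says that slabs `|f - a| ≤ t` of cost differences have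
volume `O(t)`. It follows from integrating by parts against a cutoff of `X` whose gradient has `L¹`
norm controlled by the Hausdorff measure of `frontier X`. -/

namespace StorageOT

/-! ### Slabs between level sets of a `C²` function. -/

section LevelSets

variable {E : Type*} [NormedAddCommGroup E] [InnerProductSpace ℝ E] [FiniteDimensional ℝ E]
  [MeasurableSpace E] [BorelSpace E]

theorem integrable_mul_of_continuousOn_tsupport {u v : E → ℝ} (hu : Continuous u)
    (hc : HasCompactSupport u) (hv : ContinuousOn v (tsupport u)) :
    Integrable (fun x => u x * v x) := by
  have h1 : IntegrableOn (fun x => u x * v x) (tsupport u) :=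
    (hu.continuousOn.mul hv).integrableOn_compact hc
  rwa [integrableOn_iff_integrable_of_support_subset] at h1
  intro x hx
  apply subset_tsupport
  intro h
  exact hx (by simp [h])

theorem integrable_fderiv_apply_mul {u v : E → ℝ} (hu : ContDiff ℝ 1 u)
    (hc : HasCompactSupport u) (hv : ContinuousOn v (tsupport u)) (e : E) :
    Integrable (fun x => fderiv ℝ u x e * v x) := by
  have hcont : Continuous fun x => fderiv ℝ u x e :=
    (hu.continuous_fderiv one_ne_zero).clm_apply continuous_const
  have hsub : tsupport (fun x => fderiv ℝ u x e) ⊆ tsupport u :=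
    tsupport_fderiv_apply_subset ℝ e
  exact integrable_mul_of_continuousOn_tsupport hcont (hc.fderiv_apply ℝ e) (hv.mono hsub)

theorem integrable_norm_fderiv {u : E → ℝ} (hu : ContDiff ℝ 1 u) (hc : HasCompactSupport u) :
    Integrable (fun x => ‖fderiv ℝ u x‖) :=
  ((hu.continuous_fderiv one_ne_zero).integrable_of_hasCompactSupport (hc.fderiv ℝ)).norm

/-- Integrate `u · ∂ₑ(χ ∂ₑf)` by parts with `χ = 2t arctan((f - a)/t)`. The derivative of `χ` with
respect to `f` is at least 1 on the slab `|f - a| ≤ t`, while `|χ| ≤ πt`, so every term moved to the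
right carries a factor `t`. -/
theorem integral_mul_sq_fderiv_le {U : Set E} (hU : IsOpen U) {f u : E → ℝ}
    (hf : ContDiffOn ℝ 2 f U) (hu : ContDiff ℝ 1 u) (hc : HasCompactSupport u)
    (hsupp : tsupport u ⊆ U) (h0 : ∀ x, 0 ≤ u x) {B₁ B₂ : ℝ} (e : E)
    (hB₁ : ∀ x ∈ tsupport u, ‖fderiv ℝ f x‖ ≤ B₁)
    (hB₂ : ∀ x ∈ tsupport u, |fderiv ℝ (fun z => fderiv ℝ f z e) x e| ≤ B₂)
    (he : ‖e‖ = 1) (a : ℝ) {t : ℝ} (ht : 0 < t) :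
    Integrable (fun x => u x * (2 / (1 + ((f x - a) / t) ^ 2) * (fderiv ℝ f x e) ^ 2)) ∧
    ∫ x, u x * (2 / (1 + ((f x - a) / t) ^ 2) * (fderiv ℝ f x e) ^ 2) ≤
      Real.pi * t * (B₁ * ∫ x, ‖fderiv ℝ u x‖) + Real.pi * t * (B₂ * ∫ x, u x) := by
  have hfd : ∀ x ∈ U, DifferentiableAt ℝ f x := fun x hx =>
    (hf.contDiffAt (hU.mem_nhds hx)).differentiableAt two_ne_zero
  have hd1 : ContDiffOn ℝ 1 (fun z => fderiv ℝ f z e) U :=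
    (hf.fderiv_of_isOpen hU (by norm_num)).clm_apply contDiffOn_const
  have hd1d : ∀ x ∈ U, DifferentiableAt ℝ (fun z => fderiv ℝ f z e) x := fun x hx =>
    (hd1.contDiffAt (hU.mem_nhds hx)).differentiableAt one_ne_zero
  have hd2 : ContinuousOn (fun z => fderiv ℝ (fun z => fderiv ℝ f z e) z e) U :=
    (hd1.continuousOn_fderiv_of_isOpen hU le_rfl).clm_apply continuousOn_const
  have hfc : ContinuousOn f (tsupport u) := hf.continuousOn.mono hsupp
  have hd1c : ContinuousOn (fun z => fderiv ℝ f z e) (tsupport u) := hd1.continuousOn.mono hsupp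
  have hd2c := hd2.mono hsupp
  set χ : E → ℝ := fun x => 2 * t * Real.arctan ((f x - a) / t) with hχ
  have hχc : ContinuousOn χ (tsupport u) :=
    continuousOn_const.mul (Real.continuous_arctan.comp_continuousOn
      ((hfc.sub continuousOn_const).div_const t))
  have hχb : ∀ x, |χ x| ≤ Real.pi * t := by
    intro x
    have := Real.arctan_lt_pi_div_two ((f x - a) / t)
    have h2 := Real.neg_pi_div_two_lt_arctan ((f x - a) / t)
    rw [abs_le]
    constructor <;> simp only [hχ] <;> nlinarith
  have hgd : ∀ x ∈ U, HasFDerivAt (fun x => χ x * fderiv ℝ f x e)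
      (χ x • fderiv ℝ (fun z => fderiv ℝ f z e) x
        + fderiv ℝ f x e • (2 / (1 + ((f x - a) / t) ^ 2)) • fderiv ℝ f x) x := by
    intro x hx
    have h1 := (hfd x hx).hasFDerivAt
    have h2 : HasDerivAt (fun s => 2 * t * Real.arctan ((s - a) / t))
        (2 / (1 + ((f x - a) / t) ^ 2)) (f x) := by
      have := ((((hasDerivAt_id (f x)).sub_const a).div_const t).arctan).const_mul (2 * t)
      refine this.congr_deriv ?_
      simp only [id]
      field_simp
    have h3 := h2.comp_hasFDerivAt x h1
    exact h3.mul (hd1d x hx).hasFDerivAt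
  have hPc : ContinuousOn (fun x => 2 / (1 + ((f x - a) / t) ^ 2) * (fderiv ℝ f x e) ^ 2)
      (tsupport u) := by
    refine ContinuousOn.mul (continuousOn_const.div ?_ ?_) (hd1c.pow 2)
    · exact continuousOn_const.add (((hfc.sub continuousOn_const).div_const t).pow 2)
    · intro x _
      positivity
  have hQc : ContinuousOn (fun x => χ x * fderiv ℝ (fun z => fderiv ℝ f z e) x e) (tsupport u) :=
    hχc.mul hd2c
  have hP := integrable_mul_of_continuousOn_tsupport hu.continuous hc hPc
  have hQ := integrable_mul_of_continuousOn_tsupport hu.continuous hc hQc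
  have huI : Integrable u := hu.continuous.integrable_of_hasCompactSupport hc
  have hduI := integrable_norm_fderiv hu hc
  refine ⟨hP, ?_⟩
  have hgder : ∀ x ∈ tsupport u, fderiv ℝ (fun x => χ x * fderiv ℝ f x e) x e =
      2 / (1 + ((f x - a) / t) ^ 2) * (fderiv ℝ f x e) ^ 2
        + χ x * fderiv ℝ (fun z => fderiv ℝ f z e) x e := by
    intro x hx
    rw [(hgd x (hsupp hx)).fderiv]
    simp only [add_apply, smul_apply, smul_eq_mul]
    ring
  have hzero : ∀ x, x ∉ tsupport u → u x = 0 := fun x hx => image_eq_zero_of_notMem_tsupport hx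
  have hEq : (fun x => u x * fderiv ℝ (fun x => χ x * fderiv ℝ f x e) x e) = fun x =>
      u x * (2 / (1 + ((f x - a) / t) ^ 2) * (fderiv ℝ f x e) ^ 2)
        + u x * (χ x * fderiv ℝ (fun z => fderiv ℝ f z e) x e) := by
    funext x
    by_cases hx : x ∈ tsupport u
    · rw [hgder x hx]; ring
    · simp [hzero x hx]
  have hibp := integral_mul_fderiv_eq_neg_fderiv_mul_of_integrable (μ := volume)
    (f := u) (g := fun x => χ x * fderiv ℝ f x e) (v := e)
    (integrable_fderiv_apply_mul hu hc (hχc.mul hd1c) e) (by rw [hEq]; exact hP.add hQ)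
    (integrable_mul_of_continuousOn_tsupport hu.continuous hc (hχc.mul hd1c))
    (fun x _ => hu.differentiable one_ne_zero x)
    (fun x hx => (hgd x (hsupp hx)).differentiableAt)
  rw [hEq, integral_add hP hQ, ← integral_neg] at hibp
  have h1 : ∫ x, -(fderiv ℝ u x e * (χ x * fderiv ℝ f x e)) ≤
      ∫ x, Real.pi * t * (B₁ * ‖fderiv ℝ u x‖) := by
    refine integral_mono (integrable_fderiv_apply_mul hu hc (hχc.mul hd1c) e).neg
      ((hduI.const_mul _).const_mul _) ?_
    intro x
    by_cases hx : x ∈ tsupport u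
    · refine (le_abs_self _).trans ?_
      simp only [abs_neg, abs_mul]
      have e1 : |fderiv ℝ u x e| ≤ ‖fderiv ℝ u x‖ := by
        simpa [he] using (fderiv ℝ u x).le_opNorm e
      have e2 : |fderiv ℝ f x e| ≤ B₁ := by
        refine le_trans ?_ (hB₁ x hx)
        simpa [he] using (fderiv ℝ f x).le_opNorm e
      calc |fderiv ℝ u x e| * (|χ x| * |fderiv ℝ f x e|)
          ≤ ‖fderiv ℝ u x‖ * ((Real.pi * t) * B₁) := by
            gcongr
            · exact hχb x
        _ = _ := by ring
    · have : fderiv ℝ u x = 0 := by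
        have := (tsupport_fderiv_subset ℝ (f := u)).trans subset_rfl
        exact image_eq_zero_of_notMem_tsupport fun h => hx (this h)
      simp [this]
  have h2 : ∫ x, -(u x * (χ x * fderiv ℝ (fun z => fderiv ℝ f z e) x e)) ≤
      ∫ x, Real.pi * t * (B₂ * u x) := by
    refine integral_mono hQ.neg ((huI.const_mul _).const_mul _) ?_
    intro x
    by_cases hx : x ∈ tsupport u
    · refine (le_abs_self _).trans ?_
      simp only [abs_neg, abs_mul, abs_of_nonneg (h0 x)]
      calc u x * (|χ x| * |fderiv ℝ (fun z => fderiv ℝ f z e) x e|)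
          ≤ u x * ((Real.pi * t) * B₂) := by
            gcongr
            · exact h0 x
            · exact hχb x
            · exact hB₂ x hx
        _ = _ := by ring
    · simp [hzero x hx]
  rw [integral_const_mul, integral_const_mul] at h1 h2
  rw [integral_neg] at h2
  linarith

/-- The `u`-weighted volume of a slab of half-width `t` between two level sets of `f` is `O(t)`,
as long as the gradient of `f` does not vanish on the support of `u`. -/
theorem setIntegral_slab_le {U : Set E} (hU : IsOpen U) {f u : E → ℝ}
    (hf : ContDiffOn ℝ 2 f U) (hu : ContDiff ℝ 1 u) (hc : HasCompactSupport u)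
    (hsupp : tsupport u ⊆ U) (h0 : ∀ x, 0 ≤ u x) {τ B₁ B₂ : ℝ} (hτ0 : 0 ≤ τ)
    (hτ : ∀ x ∈ tsupport u, τ ≤ ‖fderiv ℝ f x‖)
    (hB₁ : ∀ x ∈ tsupport u, ‖fderiv ℝ f x‖ ≤ B₁)
    (hB₂ : ∀ e : E, ‖e‖ = 1 → ∀ x ∈ tsupport u, |fderiv ℝ (fun z => fderiv ℝ f z e) x e| ≤ B₂)
    (a : ℝ) {t : ℝ} (ht : 0 < t) {S : Set E} (hS : MeasurableSet S)
    (hSt : ∀ x ∈ S, |f x - a| ≤ t) :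
    τ ^ 2 * ∫ x in S, u x ≤ Module.finrank ℝ E *
      (Real.pi * t * (B₁ * (∫ x, ‖fderiv ℝ u x‖) + B₂ * ∫ x, u x)) := by
  -- Summing the directional estimates over an orthonormal basis rebuilds `‖fderiv ℝ f x‖ ^ 2`, at
  -- the price of the factor `finrank`.
  let b := stdOrthonormalBasis ℝ E
  have key := fun i => integral_mul_sq_fderiv_le hU hf hu hc hsupp h0 (b i) hB₁
    (hB₂ (b i) (b.norm_eq_one i)) (b.norm_eq_one i) a ht
  have huI : Integrable u := hu.continuous.integrable_of_hasCompactSupport hc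
  have hsum : ∫ x, ∑ i, u x * (2 / (1 + ((f x - a) / t) ^ 2) * (fderiv ℝ f x (b i)) ^ 2) ≤
      Module.finrank ℝ E *
      (Real.pi * t * (B₁ * (∫ x, ‖fderiv ℝ u x‖) + B₂ * ∫ x, u x)) := by
    rw [integral_finsetSum _ fun i _ => (key i).1]
    refine (Finset.sum_le_sum fun i _ => (key i).2).trans (le_of_eq ?_)
    simp only [Finset.sum_const, Finset.card_univ, Fintype.card_fin, nsmul_eq_mul]
    ring
  refine le_trans ?_ hsum
  rw [← integral_indicator hS, ← integral_const_mul]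
  refine integral_mono ((huI.indicator hS).const_mul _)
    (integrable_finsetSum _ fun i _ => (key i).1) ?_
  intro x
  have hpos : 0 ≤ ∑ i, u x * (2 / (1 + ((f x - a) / t) ^ 2) * (fderiv ℝ f x (b i)) ^ 2) :=
    Finset.sum_nonneg fun i _ => mul_nonneg (h0 x) (by positivity)
  by_cases hx : x ∈ S
  · by_cases hxu : x ∈ tsupport u
    · simp only [Set.indicator_of_mem hx]
      rw [← Finset.mul_sum, ← Finset.mul_sum, mul_comm]
      refine mul_le_mul_of_nonneg_left ?_ (h0 x)
      have e1 : ∑ i, (fderiv ℝ f x (b i)) ^ 2 = ‖fderiv ℝ f x‖ ^ 2 := by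
        have h := b.sum_sq_norm_inner_left ((InnerProductSpace.toDual ℝ E).symm (fderiv ℝ f x))
        simp only [InnerProductSpace.toDual_symm_apply, LinearIsometryEquiv.norm_map,
          Real.norm_eq_abs, sq_abs] at h
        exact h
      have e2 : ((f x - a) / t) ^ 2 ≤ 1 := by
        rw [sq_le_one_iff_abs_le_one, abs_div, abs_of_pos ht, div_le_one ht]
        exact hSt x hx
      have e3 : 1 ≤ 2 / (1 + ((f x - a) / t) ^ 2) := by
        rw [le_div_iff₀ (by positivity)]
        linarith
      rw [e1]
      have e4 : τ ^ 2 ≤ ‖fderiv ℝ f x‖ ^ 2 := by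
        have := hτ x hxu
        gcongr
      nlinarith [sq_nonneg ‖fderiv ℝ f x‖]
    · have : u x = 0 := image_eq_zero_of_notMem_tsupport hxu
      simp [this, hx]
  · simpa [Set.indicator_of_notMem hx] using hpos

/-- The level sets of a `C²` function are null near its regular points. -/
theorem volume_levelSet_eq_zero {U : Set E} (hU : IsOpen U) {f : E → ℝ}
    (hf : ContDiffOn ℝ 2 f U) {Z : Set E} (hZ : MeasurableSet Z) (hZU : Z ⊆ U)
    (hreg : ∀ x ∈ Z, fderiv ℝ f x ≠ 0) (a : ℝ) (hZa : ∀ x ∈ Z, f x = a) :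
    volume Z = 0 := by
  refine measure_null_of_locally_null Z fun x₀ hx₀ => ?_
  have hdc : ContinuousOn (fderiv ℝ f) U := hf.continuousOn_fderiv_of_isOpen hU (by norm_num)
  have hV : IsOpen (U ∩ (fderiv ℝ f) ⁻¹' {0}ᶜ) :=
    hdc.isOpen_inter_preimage hU isOpen_compl_singleton
  have hx₀V : x₀ ∈ U ∩ (fderiv ℝ f) ⁻¹' {0}ᶜ := ⟨hZU hx₀, hreg x₀ hx₀⟩
  obtain ⟨r, hr, hrV⟩ := Metric.isOpen_iff.1 hV x₀ hx₀V
  -- The bump is supported where the gradient does not vanish; compactness of its support supplies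
  -- the constants of the slab estimate.
  let u : ContDiffBump x₀ := ⟨r / 4, r / 2, by positivity, by linarith⟩
  have hts : tsupport u ⊆ U ∩ (fderiv ℝ f) ⁻¹' {0}ᶜ := by
    rw [u.tsupport_eq]
    exact (Metric.closedBall_subset_ball (by change r / 2 < r; linarith)).trans hrV
  have hcomp : IsCompact (tsupport u) := u.hasCompactSupport
  have htsU : tsupport u ⊆ U := hts.trans Set.inter_subset_left
  have hfc : ContinuousOn (fun x => ‖fderiv ℝ f x‖) (tsupport u) := (hdc.mono htsU).norm
  have hne : (tsupport u).Nonempty := by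
    rw [u.tsupport_eq]
    exact ⟨x₀, Metric.mem_closedBall_self u.rOut_pos.le⟩
  obtain ⟨p, hp, hpmin⟩ := hcomp.exists_isMinOn hne hfc
  obtain ⟨B₁, hB₁⟩ := hcomp.bddAbove_image hfc
  have hd2 : ContinuousOn (fun x => ‖fderiv ℝ (fderiv ℝ f) x‖) (tsupport u) :=
    (((hf.fderiv_of_isOpen hU (m := 1) (by norm_num)).continuousOn_fderiv_of_isOpen hU
      le_rfl).mono htsU).norm
  obtain ⟨B₂, hB₂⟩ := hcomp.bddAbove_image hd2
  have hτ : 0 < ‖fderiv ℝ f p‖ := norm_pos_iff.2 (hts hp).2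
  have key := fun (t : ℝ) (ht : 0 < t) => setIntegral_slab_le hU hf (u.contDiff (n := 1))
    u.hasCompactSupport htsU
    (fun x => u.nonneg) hτ.le (fun x hx => hpmin hx)
    (fun x hx => hB₁ (Set.mem_image_of_mem _ hx)) (B₂ := B₂)
    (fun e he x hx => by
      have hdd : DifferentiableAt ℝ (fderiv ℝ f) x :=
        ((hf.fderiv_of_isOpen hU (m := 1) (by norm_num)).contDiffAt
          (hU.mem_nhds (htsU hx))).differentiableAt one_ne_zero
      have : fderiv ℝ (fun z => fderiv ℝ f z e) x e = fderiv ℝ (fderiv ℝ f) x e e := by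
        rw [fderiv_clm_apply hdd (differentiableAt_const e)]
        simp
      rw [this]
      refine le_trans ?_ (hB₂ (Set.mem_image_of_mem _ hx))
      simpa [he] using (fderiv ℝ (fderiv ℝ f) x).le_opNorm₂ e e)
    a ht hZ (fun x hx => by simp [hZa x hx, ht.le])
  set D := B₁ * (∫ x, ‖fderiv ℝ u x‖) + B₂ * ∫ x, u x with hD
  -- `Z` lies in slabs of every half-width `t > 0`, so `t` may tend to 0.
  have hint : ∫ x in Z, u x ≤ 0 := by
    have hlim : Filter.Tendsto (fun t : ℝ => Module.finrank ℝ E * (Real.pi * t * D))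
        (nhdsWithin 0 (Set.Ioi 0)) (nhds 0) := by
      have : Continuous fun t : ℝ => (Module.finrank ℝ E : ℝ) * (Real.pi * t * D) := by fun_prop
      have := this.tendsto 0
      simp only [mul_zero, zero_mul] at this
      exact this.mono_left nhdsWithin_le_nhds
    have h2 := ge_of_tendsto hlim (b := ‖fderiv ℝ f p‖ ^ 2 * ∫ x in Z, u x) (by
      filter_upwards [self_mem_nhdsWithin] with t ht using key t ht)
    by_contra hcon
    push Not at hcon
    have : 0 < ‖fderiv ℝ f p‖ ^ 2 * ∫ x in Z, u x := by positivity
    linarith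
  have huI : Integrable u := u.continuous.integrable_of_hasCompactSupport u.hasCompactSupport
  refine ⟨Z ∩ Metric.ball x₀ (r / 4),
    inter_mem_nhdsWithin _ (Metric.ball_mem_nhds _ (by positivity)), ?_⟩
  have hm : MeasurableSet (Z ∩ Metric.ball x₀ (r / 4)) := hZ.inter measurableSet_ball
  have h3 : ∫ x in Z ∩ Metric.ball x₀ (r / 4), u x ≤ ∫ x in Z, u x :=
    setIntegral_mono_set huI.integrableOn (Filter.Eventually.of_forall fun x => u.nonneg)
      (Filter.Eventually.of_forall Set.inter_subset_left)
  have h4 : ∫ x in Z ∩ Metric.ball x₀ (r / 4), u x = volume.real (Z ∩ Metric.ball x₀ (r / 4)) := by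
    rw [setIntegral_congr_fun (g := fun _ => (1 : ℝ)) hm, setIntegral_const, smul_eq_mul, mul_one]
    intro x hx
    exact u.one_of_mem_closedBall (Metric.ball_subset_closedBall hx.2)
  have h5 : volume.real (Z ∩ Metric.ball x₀ (r / 4)) = 0 :=
    le_antisymm (by linarith) measureReal_nonneg
  rwa [measureReal_eq_zero_iff (measure_ne_top_of_subset Set.inter_subset_right
    measure_ball_lt_top.ne)] at h5

end LevelSets

/-! ### Cutoff functions and the volume of `X`, controlled by its boundary. -/

section Cutoff

/-- A compact set of finite `m`-dimensional Hausdorff measure is covered by finitely many small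
balls whose radii have a controlled sum of `m`-th powers. -/
theorem exists_finite_ball_cover {E : Type*} [MetricSpace E] [Nonempty E] [MeasurableSpace E]
    [BorelSpace E] {s : Set E} (hs : IsCompact s) {m : ℕ} (hm : 1 ≤ m) {A : ℝ} (hA : 0 ≤ A)
    (hsA : Measure.hausdorffMeasure (m : ℝ) s ≤ ENNReal.ofReal A) {δ : ℝ} (hδ : 0 < δ) :
    ∃ (J : Finset ℕ) (x : ℕ → E) (r : ℕ → ℝ), (∀ j, 0 < r j ∧ r j ≤ δ) ∧
      s ⊆ ⋃ j ∈ J, Metric.ball (x j : E) (r j) ∧ ∑ j ∈ J, r j ^ m ≤ 2 ^ m * (A + 2) := by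
  classical
  -- The extra 1 makes the inequality strict, so that an actual cover satisfies it.
  have hlt : (⨅ (t : ℕ → Set E) (_ : s ⊆ ⋃ n, t n)
      (_ : ∀ n, Metric.ediam (t n) ≤ ENNReal.ofReal (δ / 2)),
      ∑' n, ⨆ _ : (t n).Nonempty, Metric.ediam (t n) ^ (m : ℝ)) < ENNReal.ofReal (A + 1) := by
    refine lt_of_le_of_lt ?_ ((ENNReal.ofReal_lt_ofReal_iff (by linarith)).2 (lt_add_one A))
    rw [Measure.hausdorffMeasure_apply] at hsA
    exact (le_iSup₂ (f := fun (r : ENNReal) (_ : 0 < r) => ⨅ (t : ℕ → Set E)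
      (_ : s ⊆ ⋃ n, t n) (_ : ∀ n, Metric.ediam (t n) ≤ r),
      ∑' n, ⨆ _ : (t n).Nonempty, Metric.ediam (t n) ^ (m : ℝ)) (ENNReal.ofReal (δ / 2))
      (by simpa using hδ)).trans hsA
  simp only [iInf_lt_iff] at hlt
  obtain ⟨t, hcov, hdiam, hsum⟩ := hlt
  -- Open balls need radii beyond the diameters of the covering sets. The surplus keeps the radii
  -- below `δ`, and its `m`-th powers add up to at most 1.
  let η : ℕ → ℝ := fun j => min (δ / 2) ((1 / 2) ^ (j + 1))
  have hη0 : ∀ j, 0 < η j := fun j => lt_min (by linarith) (by positivity)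
  let D : ℕ → ℝ := fun j => (Metric.ediam (t j)).toReal
  have hD0 : ∀ j, 0 ≤ D j := fun j => ENNReal.toReal_nonneg
  have hfin : ∀ j, Metric.ediam (t j) ≠ ⊤ := fun j => ne_top_of_le_ne_top ENNReal.ofReal_ne_top
    (hdiam j)
  have hD : ∀ j, D j ≤ δ / 2 := fun j => ENNReal.toReal_le_of_le_ofReal (by linarith) (hdiam j)
  let x : ℕ → E := fun j => if h : (t j).Nonempty then h.some else Classical.arbitrary E
  have hball : ∀ j, t j ⊆ Metric.ball (x j) (D j + η j) := by
    intro j z hz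
    have hne : (t j).Nonempty := ⟨z, hz⟩
    have hx : x j ∈ t j := by
      simp only [x, dif_pos hne]
      exact hne.some_mem
    rw [Metric.mem_ball, dist_edist]
    have := ENNReal.toReal_mono (hfin j) (Metric.edist_le_ediam_of_mem hz hx)
    have h2 := hη0 j
    change _ ≤ D j at this
    linarith
  obtain ⟨J, hJ⟩ := hs.elim_finite_subcover (fun j => Metric.ball (x j) (D j + η j))
    (fun j => Metric.isOpen_ball) (hcov.trans (Set.iUnion_mono hball))
  refine ⟨J, x, fun j => D j + η j, fun j => ⟨by linarith [hD0 j, hη0 j], ?_⟩, hJ, ?_⟩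
  · have : η j ≤ δ / 2 := min_le_left _ _
    linarith [hD j]
  have hDsum : ∑ j ∈ J, D j ^ m ≤ A + 1 := by
    have h1 : ∑ j ∈ J, Metric.ediam (t j) ^ m ≤ ENNReal.ofReal (A + 1) := by
      refine le_trans ?_ hsum.le
      refine le_trans ?_ (ENNReal.sum_le_tsum J)
      refine Finset.sum_le_sum fun j _ => ?_
      by_cases h : (t j).Nonempty
      · simp [h]
      · rw [Set.not_nonempty_iff_eq_empty] at h
        simp [h, Nat.one_le_iff_ne_zero.1 hm]
    have h2 := ENNReal.toReal_le_of_le_ofReal (by linarith) h1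
    rw [ENNReal.toReal_sum fun j _ => ENNReal.pow_ne_top (hfin j)] at h2
    simpa [ENNReal.toReal_pow] using h2
  have hηsum : ∑ j ∈ J, η j ^ m ≤ 1 := by
    have h1 : ∀ j, η j ^ m ≤ (1 : ℝ) / 2 / 2 ^ j := by
      intro j
      have hle : η j ≤ (1 / 2) ^ (j + 1) := min_le_right _ _
      have hle1 : η j ≤ 1 := hle.trans (pow_le_one₀ (by norm_num) (by norm_num))
      refine (pow_le_of_le_one (hη0 j).le hle1 (Nat.one_le_iff_ne_zero.1 hm)).trans
        (hle.trans (le_of_eq ?_))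
      rw [pow_succ, one_div, inv_pow]
      field_simp
    refine (Finset.sum_le_sum fun j _ => h1 j).trans ?_
    refine ((summable_geometric_two' 1).sum_le_tsum J fun j _ => by positivity).trans ?_
    rw [tsum_geometric_two']
  calc ∑ j ∈ J, (D j + η j) ^ m ≤ ∑ j ∈ J, 2 ^ (m - 1) * (D j ^ m + η j ^ m) :=
        Finset.sum_le_sum fun j _ => add_pow_le (hD0 j) (hη0 j).le m
    _ = 2 ^ (m - 1) * (∑ j ∈ J, D j ^ m + ∑ j ∈ J, η j ^ m) := by
        rw [← Finset.mul_sum, Finset.sum_add_distrib]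
    _ ≤ 2 ^ m * (A + 2) := by
        have : (2 : ℝ) ^ (m - 1) ≤ 2 ^ m := pow_le_pow_right₀ (by norm_num) (Nat.sub_le _ _)
        refine mul_le_mul this (by linarith) ?_ (by positivity)
        exact add_nonneg (Finset.sum_nonneg fun j _ => pow_nonneg (hD0 j) _)
          (Finset.sum_nonneg fun j _ => pow_nonneg (hη0 j).le _)

/-- The indicator function of `X`, cut off by balls around its boundary. -/
theorem exists_cutoff {n : ℕ} (hn : 2 ≤ n) {A : ℝ} (hA : 0 ≤ A) :
    ∃ C : ℝ, 0 ≤ C ∧ ∀ X : Set (Euc n), IsCompact X →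
      Measure.hausdorffMeasure ((n : ℝ) - 1) (frontier X) ≤ ENNReal.ofReal A →
      ∀ δ > 0, ∃ u : Euc n → ℝ, ContDiff ℝ 1 u ∧ HasCompactSupport u ∧ tsupport u ⊆ interior X ∧
        (∀ x, 0 ≤ u x) ∧ (∀ x, u x ≤ 1) ∧ ∫ x, ‖fderiv ℝ u x‖ ≤ C ∧
        volume.real (X ∩ {x | u x ≠ 1}) ≤ δ := by
  classical
  obtain ⟨m, rfl⟩ : ∃ m, n = m + 1 := ⟨n - 1, by omega⟩
  have hm : 1 ≤ m := by omega
  let β : ContDiffBump (0 : Euc (m + 1)) := ⟨1, 2, by norm_num, by norm_num⟩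
  have hβc : ContDiff ℝ 1 β := β.contDiff (n := 1)
  obtain ⟨K, hK⟩ := (β.hasCompactSupport.fderiv ℝ).exists_bound_of_continuous
    (hβc.continuous_fderiv one_ne_zero)
  have hK0 : 0 ≤ K := (norm_nonneg _).trans (hK 0)
  set ω : ℝ := volume.real (Metric.ball (0 : Euc (m + 1)) 1) with hω
  have hω0 : 0 ≤ ω := measureReal_nonneg
  refine ⟨K * (2 ^ (m + 1) * ω * (2 ^ m * (A + 2))), by positivity, fun X hX hXA δ hδ => ?_⟩
  set Q : ℝ := 2 ^ (m + 1) * ω * (2 ^ m * (A + 2)) with hQ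
  have hQ0 : 0 ≤ Q := by positivity
  -- The gradient integral scales like `∑ r ^ m`, which is bounded independently of `δ`; the
  -- discarded volume scales like `∑ r ^ (m + 1)` and gains the mesh size `δ / (Q + 1)`.
  obtain ⟨J, c, r, hr, hcov, hsum⟩ := exists_finite_ball_cover (s := frontier X)
    (hX.of_isClosed_subset isClosed_frontier hX.isClosed.frontier_subset) hm hA
    (by simpa using hXA) (δ := δ / (Q + 1)) (by positivity)
  let φ : ℕ → Euc (m + 1) → ℝ := fun j x => 1 - β ((r j)⁻¹ • (x - c j))
  have hφ0 : ∀ j x, 0 ≤ φ j x := fun j x => sub_nonneg.2 β.le_one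
  have hφ1 : ∀ j x, φ j x ≤ 1 := fun j x => sub_le_self _ β.nonneg
  have hφin : ∀ j x, x ∈ Metric.ball (c j) (r j) → φ j x = 0 := by
    intro j x hx
    have : β ((r j)⁻¹ • (x - c j)) = 1 := by
      apply β.one_of_mem_closedBall
      rw [mem_closedBall_zero_iff, norm_smul, norm_inv, Real.norm_of_nonneg (hr j).1.le]
      change (r j)⁻¹ * ‖x - c j‖ ≤ 1
      rw [inv_mul_le_iff₀ (hr j).1, mul_one, ← dist_eq_norm]
      exact (Metric.mem_ball.1 hx).le
    simp [φ, this]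
  have hout : ∀ j x, x ∉ Metric.closedBall (c j) (2 * r j) →
      (r j)⁻¹ • (x - c j) ∉ tsupport β := by
    intro j x hx h
    apply hx
    rw [β.tsupport_eq, mem_closedBall_zero_iff, norm_smul, norm_inv,
      Real.norm_of_nonneg (hr j).1.le] at h
    change (r j)⁻¹ * ‖x - c j‖ ≤ 2 at h
    rw [inv_mul_le_iff₀ (hr j).1, ← dist_eq_norm] at h
    rw [Metric.mem_closedBall]
    linarith
  have hφd : ∀ j x, HasFDerivAt (φ j)
      (-((r j)⁻¹ • fderiv ℝ β ((r j)⁻¹ • (x - c j)))) x := by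
    intro j x
    have h1 : HasFDerivAt (fun x : Euc (m + 1) => (r j)⁻¹ • (x - c j))
        ((r j)⁻¹ • ContinuousLinearMap.id ℝ (Euc (m + 1))) x :=
      ((hasFDerivAt_id x).sub_const (c j)).fun_const_smul _
    have h2 := ((hβc.differentiable one_ne_zero ((r j)⁻¹ • (x - c j))).hasFDerivAt.comp x
      h1).const_sub 1
    refine h2.congr_fderiv ?_
    ext v
    simp
  have hφc : ∀ j, ContDiff ℝ 1 (φ j) := fun j => contDiff_const.sub (hβc.comp (by fun_prop))
  let h : ℕ → Euc (m + 1) → ℝ := fun j x =>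
    (r j)⁻¹ * (Metric.closedBall (c j) (2 * r j)).indicator (fun _ => K) x
  have hh0 : ∀ j x, 0 ≤ h j x := fun j x =>
    mul_nonneg (inv_nonneg.2 (hr j).1.le) (Set.indicator_nonneg (fun _ _ => hK0) x)
  have hφn : ∀ j x, ‖-((r j)⁻¹ • fderiv ℝ β ((r j)⁻¹ • (x - c j)))‖ ≤ h j x := by
    intro j x
    rw [norm_neg, norm_smul, norm_inv, Real.norm_of_nonneg (hr j).1.le]
    refine mul_le_mul_of_nonneg_left ?_ (inv_nonneg.2 (hr j).1.le)
    by_cases hx : x ∈ Metric.closedBall (c j) (2 * r j)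
    · rw [Set.indicator_of_mem hx]
      exact hK _
    · have : fderiv ℝ β ((r j)⁻¹ • (x - c j)) = 0 :=
        image_eq_zero_of_notMem_tsupport fun h => hout j x hx (tsupport_fderiv_subset ℝ h)
      simp [Set.indicator_of_notMem hx, this]
  let η : Euc (m + 1) → ℝ := fun x => ∏ j ∈ J, φ j x
  have hη0 : ∀ x, 0 ≤ η x := fun x => Finset.prod_nonneg fun j _ => hφ0 j x
  have hη1 : ∀ x, η x ≤ 1 := fun x => Finset.prod_le_one (fun j _ => hφ0 j x) fun j _ => hφ1 j x
  have hηc : ContDiff ℝ 1 η := contDiff_prod fun j _ => hφc j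
  have hηd : ∀ x, ‖fderiv ℝ η x‖ ≤ ∑ j ∈ J, h j x := by
    intro x
    have h1 := HasFDerivAt.finsetProd (u := J) (g := φ) fun j _ => hφd j x
    rw [h1.fderiv]
    refine (norm_sum_le _ _).trans (Finset.sum_le_sum fun j _ => ?_)
    rw [norm_smul, Real.norm_of_nonneg (Finset.prod_nonneg fun i _ => hφ0 i x)]
    calc _ ≤ 1 * h j x := mul_le_mul (Finset.prod_le_one (fun i _ => hφ0 i x) fun i _ => hφ1 i x)
          (hφn j x) (norm_nonneg _) zero_le_one
      _ = h j x := one_mul _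
  let u : Euc (m + 1) → ℝ := X.indicator η
  have hu_in : ∀ x ∈ interior X, u =ᶠ[nhds x] η := fun x hx => by
    filter_upwards [isOpen_interior.mem_nhds hx] with z hz
    exact Set.indicator_of_mem (interior_subset hz) η
  have hu_out : ∀ x, x ∉ interior X → u =ᶠ[nhds x] 0 := by
    intro x hx
    by_cases hxX : x ∈ X
    · have hxf : x ∈ frontier X := by
        rw [hX.isClosed.frontier_eq]
        exact ⟨hxX, hx⟩
      obtain ⟨j, hj, hxj⟩ := Set.mem_iUnion₂.1 (hcov hxf)
      filter_upwards [Metric.isOpen_ball.mem_nhds hxj] with z hz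
      have : η z = 0 := Finset.prod_eq_zero hj (hφin j z hz)
      by_cases hzX : z ∈ X <;> simp [u, hzX, this]
    · filter_upwards [hX.isClosed.isOpen_compl.mem_nhds hxX] with z hz
      exact Set.indicator_of_notMem hz η
  have huc : ContDiff ℝ 1 u := contDiff_iff_contDiffAt.2 fun x => by
    by_cases hx : x ∈ interior X
    · exact hηc.contDiffAt.congr_of_eventuallyEq (hu_in x hx)
    · exact contDiffAt_const.congr_of_eventuallyEq (hu_out x hx)
  have hts : tsupport u ⊆ interior X := fun x hx => by
    by_contra hxi
    exact (notMem_tsupport_iff_eventuallyEq.2 (hu_out x hxi)) hx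
  have hud : ∀ x, ‖fderiv ℝ u x‖ ≤ ∑ j ∈ J, h j x := by
    intro x
    by_cases hx : x ∈ interior X
    · rw [(hu_in x hx).fderiv_eq]
      exact hηd x
    · rw [(hu_out x hx).fderiv_eq]
      simpa using Finset.sum_nonneg fun j _ => hh0 j x
  have hcomp : HasCompactSupport u :=
    hX.of_isClosed_subset (isClosed_tsupport u) (hts.trans interior_subset)
  have hvol : ∀ j, volume.real (Metric.closedBall (c j) (2 * r j)) =
      2 ^ (m + 1) * ω * (r j ^ m * r j) := by
    intro j
    rw [Measure.addHaar_real_closedBall _ _ (by linarith [(hr j).1]), finrank_euclideanSpace_fin]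
    ring
  refine ⟨u, huc, hcomp, hts, fun x => Set.indicator_nonneg (fun z _ => hη0 z) x,
    fun x => Set.indicator_le_self' (fun z _ => hη0 z) x |>.trans (hη1 x), ?_, ?_⟩
  · have hint : ∀ j ∈ J, Integrable (h j) := fun j _ =>
      ((integrable_indicator_iff Metric.isClosed_closedBall.measurableSet).2
        (integrableOn_const measure_closedBall_lt_top.ne)).const_mul _
    calc ∫ x, ‖fderiv ℝ u x‖ ≤ ∫ x, ∑ j ∈ J, h j x :=
          integral_mono (integrable_norm_fderiv huc hcomp) (integrable_finsetSum _ hint) hud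
      _ = ∑ j ∈ J, K * (2 ^ (m + 1) * ω) * r j ^ m := by
          rw [integral_finsetSum _ hint]
          refine Finset.sum_congr rfl fun j _ => ?_
          simp only [h]
          rw [integral_const_mul, integral_indicator Metric.isClosed_closedBall.measurableSet,
            setIntegral_const, hvol]
          have := (hr j).1
          simp only [smul_eq_mul]
          field_simp
      _ = K * (2 ^ (m + 1) * ω * ∑ j ∈ J, r j ^ m) := by
          rw [← Finset.mul_sum]
          ring
      _ ≤ K * Q := by
          rw [hQ]
          gcongr
  · have hsub : X ∩ {x | u x ≠ 1} ⊆ ⋃ j ∈ J, Metric.closedBall (c j) (2 * r j) := by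
      rintro x ⟨hxX, hx⟩
      by_contra hcon
      simp only [Set.mem_iUnion, not_exists] at hcon
      apply hx
      simp only [u, Set.indicator_of_mem hxX, η]
      refine Finset.prod_eq_one fun j hj => ?_
      have : β ((r j)⁻¹ • (x - c j)) = 0 :=
        image_eq_zero_of_notMem_tsupport (hout j x (hcon j hj))
      simp [φ, this]
    have hfin : volume (⋃ j ∈ J, Metric.closedBall (c j) (2 * r j)) ≠ ⊤ :=
      (measure_biUnion_lt_top J.finite_toSet fun j _ => measure_closedBall_lt_top).ne
    calc volume.real (X ∩ {x | u x ≠ 1})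
        ≤ volume.real (⋃ j ∈ J, Metric.closedBall (c j) (2 * r j)) := measureReal_mono hsub hfin
      _ ≤ ∑ j ∈ J, volume.real (Metric.closedBall (c j) (2 * r j)) :=
          measureReal_biUnion_finset_le _ _
      _ ≤ ∑ j ∈ J, 2 ^ (m + 1) * ω * (r j ^ m * (δ / (Q + 1))) := by
          refine Finset.sum_le_sum fun j _ => ?_
          rw [hvol]
          have := (hr j).1
          gcongr
          exact (hr j).2
      _ = (2 ^ (m + 1) * ω * ∑ j ∈ J, r j ^ m) * (δ / (Q + 1)) := by
          rw [Finset.mul_sum, Finset.sum_mul]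
          exact Finset.sum_congr rfl fun j _ => by ring
      _ ≤ Q * (δ / (Q + 1)) := by
          rw [hQ]
          gcongr
      _ ≤ δ := by
          rw [← mul_div_assoc, div_le_iff₀ (by linarith)]
          nlinarith

/-- An isoperimetric bound: the Gagliardo–Nirenberg–Sobolev inequality with exponent `n / (n - 1)`,
applied to cutoffs that equal 1 on `X` up to volume `δ`. -/
theorem exists_volume_le {n : ℕ} (hn : 2 ≤ n) {A : ℝ} (hA : 0 ≤ A) :
    ∃ C : ℝ, 0 ≤ C ∧ ∀ X : Set (Euc n), IsCompact X →
      Measure.hausdorffMeasure ((n : ℝ) - 1) (frontier X) ≤ ENNReal.ofReal A →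
      volume.real X ≤ C := by
  obtain ⟨C, hC, hcut⟩ := exists_cutoff hn hA
  let p : ℝ := Real.conjExponent n
  have hp : Real.HolderConjugate (Module.finrank ℝ (Euc n)) p := by
    rw [finrank_euclideanSpace_fin]
    exact Real.HolderConjugate.conjExponent (by exact_mod_cast hn)
  let K := lintegralPowLePowLIntegralFDerivConst (volume : Measure (Euc n)) p
  refine ⟨K * C ^ p, by positivity, fun X hX hXA => ?_⟩
  refine le_of_forall_pos_le_add fun δ hδ => ?_
  obtain ⟨u, hu, hc, hts, h0, h1, hgrad, hbad⟩ := hcut X hX hXA δ hδ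
  have hsob := lintegral_pow_le_pow_lintegral_fderiv volume hu hc hp
  have hI : ∫⁻ x, ‖fderiv ℝ u x‖ₑ ≤ ENNReal.ofReal C := by
    rw [← ofReal_integral_norm_eq_lintegral_enorm
      ((hu.continuous_fderiv one_ne_zero).integrable_of_hasCompactSupport (hc.fderiv ℝ))]
    exact ENNReal.ofReal_le_ofReal hgrad
  have hgood : volume (X ∩ {x | u x = 1}) ≤ ENNReal.ofReal (K * C ^ p) := by
    calc volume (X ∩ {x | u x = 1}) ≤ volume {x | 1 ≤ ‖u x‖ₑ ^ p} := by
          refine measure_mono fun x hx => ?_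
          simp [show u x = 1 from hx.2]
      _ ≤ ∫⁻ x, ‖u x‖ₑ ^ p := by
          have := mul_meas_ge_le_lintegral (μ := volume) (f := fun x => ‖u x‖ₑ ^ p)
            (by have := hu.continuous.measurable; fun_prop) 1
          simpa using this
      _ ≤ K * (∫⁻ x, ‖fderiv ℝ u x‖ₑ) ^ p := hsob
      _ ≤ K * (ENNReal.ofReal C) ^ p := by
          gcongr
          exact hp.symm.nonneg
      _ = ENNReal.ofReal (K * C ^ p) := by
          rw [ENNReal.ofReal_rpow_of_nonneg hC hp.symm.nonneg, ENNReal.ofReal_mul K.coe_nonneg,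
            ENNReal.ofReal_coe_nnreal]
  have hsplit : X = (X ∩ {x | u x = 1}) ∪ (X ∩ {x | u x ≠ 1}) := by
    ext x
    by_cases h : u x = 1 <;> simp [h]
  have hXfin := hX.measure_lt_top (μ := volume)
  calc volume.real X ≤ volume.real (X ∩ {x | u x = 1}) + volume.real (X ∩ {x | u x ≠ 1}) := by
        conv_lhs => rw [hsplit]
        exact measureReal_union_le _ _
    _ ≤ K * C ^ p + δ := by
        gcongr
        exact ENNReal.toReal_le_of_le_ofReal (by positivity) hgood

end Cutoff

/-! ### Volume of slabs inside `X`. -/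

section Slab

/-- The weighted slab estimate is used with cutoffs of `X`. Its constants do not depend on `δ`, so
the volume lost near the boundary can be sent to 0. The final `+ 1` only keeps the constant
positive. -/
theorem exists_volume_slab_le {n : ℕ} (hn : 2 ≤ n) {A B τ : ℝ} (hA : 0 ≤ A) (hB : 0 ≤ B)
    (hτ : 0 < τ) :
    ∃ C : ℝ, 0 < C ∧ ∀ X : Set (Euc n), IsCompact X →
      Measure.hausdorffMeasure ((n : ℝ) - 1) (frontier X) ≤ ENNReal.ofReal A →
      ∀ (U : Set (Euc n)) (f : Euc n → ℝ), IsOpen U → X ⊆ U → ContDiffOn ℝ 2 f U →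
        (∀ x ∈ X, τ ≤ ‖fderiv ℝ f x‖) → (∀ x ∈ X, ‖fderiv ℝ f x‖ ≤ B) →
        (∀ e : Euc n, ‖e‖ = 1 → ∀ x ∈ X, |fderiv ℝ (fun z => fderiv ℝ f z e) x e| ≤ B) →
        ∀ (a t : ℝ), 0 < t → ∀ S : Set (Euc n), MeasurableSet S → S ⊆ X →
          (∀ x ∈ S, |f x - a| ≤ t) → volume.real S ≤ C * t := by
  obtain ⟨C₀, hC₀, hcut⟩ := exists_cutoff hn hA
  obtain ⟨C₁, hC₁, hvol⟩ := exists_volume_le hn hA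
  refine ⟨n * Real.pi * (B * C₀ + B * C₁) / τ ^ 2 + 1, by positivity, ?_⟩
  intro X hX hXA U f hU hXU hf hτf hB₁ hB₂ a t ht S hS hSX hSt
  have hmain : ∀ δ > 0, volume.real S ≤ n * Real.pi * (B * C₀ + B * C₁) / τ ^ 2 * t + δ := by
    intro δ hδ
    obtain ⟨u, hu, hc, hts, h0, h1, hgrad, hbad⟩ := hcut X hX hXA δ hδ
    have htsX : tsupport u ⊆ X := hts.trans interior_subset
    have hslab := setIntegral_slab_le hU hf hu hc (htsX.trans hXU) h0 hτ.le
      (fun x hx => hτf x (htsX hx)) (fun x hx => hB₁ x (htsX hx))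
      (fun e he x hx => hB₂ e he x (htsX hx)) a ht hS hSt
    rw [finrank_euclideanSpace_fin] at hslab
    have huI : Integrable u := hu.continuous.integrable_of_hasCompactSupport hc
    have hXfin : volume X ≠ ⊤ := hX.measure_lt_top.ne
    have hXm : MeasurableSet X := hX.isClosed.measurableSet
    have hu1 : ∫ x, u x ≤ C₁ := by
      refine le_trans ?_ (hvol X hX hXA)
      rw [← setIntegral_eq_integral_of_forall_compl_eq_zero (s := X) (fun x hx =>
        image_eq_zero_of_notMem_tsupport fun h => hx (htsX h))]
      have := setIntegral_mono_on huI.integrableOn (integrableOn_const (C := (1 : ℝ)) hXfin) hXm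
        (fun x _ => h1 x)
      simpa using this
    have hS1 : volume.real (S ∩ {x | u x = 1}) ≤ ∫ x in S, u x := by
      have hm : MeasurableSet (S ∩ {x | u x = 1}) :=
        hS.inter (hu.continuous.measurable (measurableSet_singleton 1))
      have e1 : ∫ x in S ∩ {x | u x = 1}, u x = volume.real (S ∩ {x | u x = 1}) := by
        rw [setIntegral_congr_fun (g := fun _ => (1 : ℝ)) hm (fun x hx => hx.2),
          setIntegral_const, smul_eq_mul, mul_one]
      rw [← e1]
      exact setIntegral_mono_set huI.integrableOn (Filter.Eventually.of_forall h0)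
        (Filter.Eventually.of_forall Set.inter_subset_left)
    have hS2 : volume.real S ≤ volume.real (S ∩ {x | u x = 1}) + δ := by
      have hsub : S ⊆ (S ∩ {x | u x = 1}) ∪ (X ∩ {x | u x ≠ 1}) := by
        intro x hx
        by_cases h : u x = 1
        · exact Or.inl ⟨hx, h⟩
        · exact Or.inr ⟨hSX hx, h⟩
      have hfin : volume ((S ∩ {x | u x = 1}) ∪ (X ∩ {x | u x ≠ 1})) ≠ ⊤ :=
        measure_ne_top_of_subset (Set.union_subset (Set.inter_subset_left.trans hSX)
          Set.inter_subset_left) hXfin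
      have := (measureReal_mono hsub hfin).trans (measureReal_union_le _ _)
      linarith
    have hS3 : τ ^ 2 * ∫ x in S, u x ≤ n * Real.pi * (B * C₀ + B * C₁) * t := by
      refine hslab.trans ?_
      calc (n : ℝ) * (Real.pi * t * (B * (∫ x, ‖fderiv ℝ u x‖) + B * ∫ x, u x))
          ≤ n * (Real.pi * t * (B * C₀ + B * C₁)) := by gcongr
        _ = _ := by ring
    have hS4 : ∫ x in S, u x ≤ n * Real.pi * (B * C₀ + B * C₁) / τ ^ 2 * t := by
      rw [div_mul_eq_mul_div, le_div_iff₀ (by positivity)]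
      linarith
    linarith
  have := le_of_forall_pos_le_add hmain
  linarith

end Slab

/-! ### Laguerre cells, negligible ties, and the Lipschitz bound for `G`. -/

section Laguerre

variable {n N : ℕ} {X : Set (Euc n)} {y : Fin N → Euc n} {c : Euc n → Euc n → ℝ}
  {μ : Measure (Euc n)}

theorem mem_Lag_iff {ψ : Euc N} {i : Fin N} {x : Euc n} :
    x ∈ Lag X y c ψ i ↔ x ∈ X ∧ ∀ k, c x (y i) + ψ i ≤ c x (y k) + ψ k := by
  have : Nonempty (Fin N) := ⟨i⟩
  have hbdd : BddAbove (Set.range fun k => -c x (y k) - ψ k) := (Set.finite_range _).bddAbove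
  simp only [Lag, cStar, Set.mem_ofPred_eq]
  refine and_congr_right fun _ => ⟨fun h k => ?_, fun h => ?_⟩
  · have := le_ciSup hbdd k
    rw [← h] at this
    dsimp only at this
    linarith
  · refine le_antisymm (le_ciSup hbdd i) (ciSup_le fun k => ?_)
    linarith [h k]

theorem Setting.continuousOn (h : Setting X y c μ) (i : Fin N) :
    ContinuousOn (fun x => c x (y i)) X := by
  obtain ⟨U, _, hXU, hf⟩ := h.reg i
  exact hf.continuousOn.mono hXU

theorem Setting.measurableSet (h : Setting X y c μ) : MeasurableSet X :=
  h.compact.isClosed.measurableSet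

theorem Setting.measurable_indicator (h : Setting X y c μ) (i : Fin N) :
    Measurable (X.indicator fun x => c x (y i)) := by
  classical
  rw [← Set.piecewise_eq_indicator]
  exact (h.continuousOn i).measurable_piecewise continuousOn_const h.measurableSet

theorem Setting.measurableSet_slab (h : Setting X y c μ) (i k : Fin N) (a t : ℝ) :
    MeasurableSet (X ∩ {x | |c x (y i) - c x (y k) - a| ≤ t}) := by
  have h1 : X ∩ {x | |c x (y i) - c x (y k) - a| ≤ t} = X ∩ {x |
      |X.indicator (fun x => c x (y i)) x - X.indicator (fun x => c x (y k)) x - a| ≤ t} := by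
    ext x
    simp only [Set.mem_inter_iff, Set.mem_ofPred_eq]
    refine and_congr_right fun hx => ?_
    rw [Set.indicator_of_mem hx, Set.indicator_of_mem hx]
  rw [h1]
  have m1 := h.measurable_indicator i
  have m2 := h.measurable_indicator k
  exact h.measurableSet.inter (measurableSet_le (by fun_prop) measurable_const)

/-- A common open neighbourhood of `X` on which a difference of two costs is `C²`. -/
theorem Setting.exists_contDiffOn_sub (h : Setting X y c μ) (i k : Fin N) :
    ∃ U : Set (Euc n), IsOpen U ∧ X ⊆ U ∧ ContDiffOn ℝ 2 (fun x => c x (y i)) U ∧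
      ContDiffOn ℝ 2 (fun x => c x (y k)) U := by
  obtain ⟨U, hU, hXU, hf⟩ := h.reg i
  obtain ⟨V, hV, hXV, hg⟩ := h.reg k
  exact ⟨U ∩ V, hU.inter hV, Set.subset_inter hXU hXV, hf.mono Set.inter_subset_left,
    hg.mono Set.inter_subset_right⟩

theorem norm_gradient_sub {f g : Euc n → ℝ} (x : Euc n) :
    ‖gradient f x - gradient g x‖ = ‖fderiv ℝ f x - fderiv ℝ g x‖ := by
  rw [gradient, gradient, ← map_sub, LinearIsometryEquiv.norm_map]

theorem Setting.fderiv_sub_eq (h : Setting X y c μ) (i k : Fin N) {x : Euc n} (hx : x ∈ X) :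
    fderiv ℝ (fun z => c z (y i) - c z (y k)) x =
      fderiv ℝ (fun z => c z (y i)) x - fderiv ℝ (fun z => c z (y k)) x := by
  obtain ⟨U, hU, hXU, hf, hg⟩ := h.exists_contDiffOn_sub i k
  exact fderiv_fun_sub
    ((hf.contDiffAt (hU.mem_nhds (hXU hx))).differentiableAt two_ne_zero)
    ((hg.contDiffAt (hU.mem_nhds (hXU hx))).differentiableAt two_ne_zero)

/-- The common boundary of two cells is negligible. -/
theorem Setting.measure_tie_eq_zero (h : Setting X y c μ) {i k : Fin N} (hik : i ≠ k) (s : ℝ) :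
    μ (X ∩ {x | c x (y i) - c x (y k) = s}) = 0 := by
  obtain ⟨U, hU, hXU, hf, hg⟩ := h.exists_contDiffOn_sub i k
  refine h.absCont (volume_levelSet_eq_zero hU (hf.sub hg) ?_
    (Set.inter_subset_left.trans hXU) ?_ s fun x hx => hx.2)
  · have := h.measurableSet_slab i k s 0
    simpa [sub_eq_zero] using this
  · intro x hx h0
    rw [h.fderiv_sub_eq i k hx.1] at h0
    apply h.twist x hx.1 i k hik
    rw [← sub_eq_zero, ← norm_eq_zero, norm_gradient_sub, h0, norm_zero]

theorem abs_fderiv_fderiv_le {f : Euc n → ℝ} {U : Set (Euc n)} (hU : IsOpen U)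
    (hf : ContDiffOn ℝ 2 f U) {x : Euc n} (hx : x ∈ U) {B : ℝ}
    (hB : ‖iteratedFDeriv ℝ 2 f x‖ ≤ B) {e : Euc n} (he : ‖e‖ = 1) :
    |fderiv ℝ (fun z => fderiv ℝ f z e) x e| ≤ B := by
  have hdd : DifferentiableAt ℝ (fderiv ℝ f) x :=
    ((hf.fderiv_of_isOpen hU (m := 1) (by norm_num)).contDiffAt
      (hU.mem_nhds hx)).differentiableAt one_ne_zero
  have h1 : fderiv ℝ (fun z => fderiv ℝ f z e) x e = iteratedFDeriv ℝ 2 f x (fun _ => e) := by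
    rw [fderiv_clm_apply hdd (differentiableAt_const e), iteratedFDeriv_two_apply]
    simp
  rw [h1]
  refine le_trans ?_ hB
  simpa [he] using (iteratedFDeriv ℝ 2 f x).le_opNorm fun _ => e

theorem exists_measure_slab_le {n : ℕ} (hn : 2 ≤ n) (N : ℕ) {M A B τ : ℝ} (hM : 0 < M)
    (hA : 0 < A) (hB : 0 < B) (hτ : 0 < τ) :
    ∃ C : ℝ, 0 < C ∧ ∀ (X : Set (Euc n)) (y : Fin N → Euc n) (c : Euc n → Euc n → ℝ)
      (μ : Measure (Euc n)), Setting X y c μ → DataBounds X y c μ M A B τ →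
      ∀ (i k : Fin N), i ≠ k → ∀ (a t : ℝ), 0 < t →
        μ.real (X ∩ {x | |c x (y i) - c x (y k) - a| ≤ t}) ≤ C * t := by
  obtain ⟨C, hC, hslab⟩ := exists_volume_slab_le hn hA.le (by positivity : 0 ≤ B + B) hτ
  refine ⟨M * C, by positivity, fun X y c μ h hd i k hik a t ht => ?_⟩
  obtain ⟨U, hU, hXU, hf, hg⟩ := h.exists_contDiffOn_sub i k
  have hS := h.measurableSet_slab i k a t
  have hnorm : ∀ j, ∀ x ∈ X, ‖fderiv ℝ (fun z => c z (y j)) x‖ ≤ B := by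
    intro j x hx
    rw [← norm_iteratedFDeriv_one]
    exact hd.costC2 j x hx 1 (by norm_num)
  have hvol := hslab X h.compact hd.boundary U _ hU hXU (hf.sub hg) (fun x hx => by
      have := hd.twist x hx i k hik
      rwa [norm_gradient_sub, ← h.fderiv_sub_eq i k hx] at this)
    (fun x hx => by
      change ‖fderiv ℝ (fun z => c z (y i) - c z (y k)) x‖ ≤ _
      rw [h.fderiv_sub_eq i k hx]
      exact (norm_sub_le _ _).trans (add_le_add (hnorm i x hx) (hnorm k x hx)))
    (fun e he x hx => by
      refine abs_fderiv_fderiv_le hU (hf.sub hg) (hXU hx) ?_ he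
      rw [fun_iteratedFDeriv_sub_apply (hf.contDiffAt (hU.mem_nhds (hXU hx)))
        (hg.contDiffAt (hU.mem_nhds (hXU hx)))]
      exact (norm_sub_le _ _).trans (add_le_add (hd.costC2 i x hx 2 le_rfl)
        (hd.costC2 k x hx 2 le_rfl)))
    a t ht _ hS Set.inter_subset_left (fun x hx => hx.2)
  have hfin : volume (X ∩ {x | |c x (y i) - c x (y k) - a| ≤ t}) ≠ ⊤ :=
    measure_ne_top_of_subset Set.inter_subset_left h.compact.measure_lt_top.ne
  have h1 := hd.density (X ∩ {x | |c x (y i) - c x (y k) - a| ≤ t})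
  rw [Measure.smul_apply, smul_eq_mul] at h1
  have h2 := ENNReal.toReal_mono (ENNReal.mul_ne_top ENNReal.ofReal_ne_top hfin) h1
  rw [ENNReal.toReal_mul, ENNReal.toReal_ofReal hM.le] at h2
  calc _ ≤ M * volume.real _ := h2
    _ ≤ M * (C * t) := by gcongr
    _ = M * C * t := by ring

theorem norm_le_sum_abs (v : Euc N) : ‖v‖ ≤ ∑ i, |v i| := by
  have h : v = ∑ i, v i • EuclideanSpace.single i (1 : ℝ) := by
    ext j
    simp [Finset.sum_apply, Pi.single_apply]
  conv_lhs => rw [h]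
  refine (norm_sum_le _ _).trans (le_of_eq ?_)
  simp [norm_smul]

theorem abs_apply_le_norm (v : Euc N) (i : Fin N) : |v i| ≤ ‖v‖ := by
  simpa using PiLp.norm_apply_le v i

/-- The measures of the cells depend on `ψ` in a Lipschitz way if slabs between level sets
of cost differences have measure proportional to their width. -/
theorem Setting.gLipschitz_of_slab (h : Setting X y c μ) {C : ℝ} (hC : 0 ≤ C)
    (hslab : ∀ (i k : Fin N), i ≠ k → ∀ (a t : ℝ), 0 < t →
        μ.real (X ∩ {x | |c x (y i) - c x (y k) - a| ≤ t}) ≤ C * t) :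
    GLipschitz X y c μ (2 * N * C * N) := by
  classical
  have := h.prob
  intro ψ φ
  rcases eq_or_ne ψ φ with rfl | hne
  · simp
  have hpos : 0 < ‖ψ - φ‖ := norm_pos_iff.2 (sub_ne_zero.2 hne)
  have hone : ∀ (ψ φ : Euc N), 0 < ‖ψ - φ‖ → ∀ i, G X y c μ ψ i - G X y c μ φ i ≤
      2 * N * C * ‖ψ - φ‖ := by
    intro ψ φ hpos i
    -- A point that leaves cell `i` is beaten by some `k`. Each price moves by at most `‖ψ - φ‖`, so
    -- the point lies within `2 * ‖ψ - φ‖` of the tie between `i` and `k`.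
    have hsub : Lag X y c ψ i ⊆ Lag X y c φ i ∪ ⋃ k ∈ Finset.univ.erase i,
        (X ∩ {x | |c x (y k) - c x (y i) - (ψ i - ψ k)| ≤ 2 * ‖ψ - φ‖}) := by
      intro x hx
      rw [mem_Lag_iff] at hx
      by_cases hx2 : x ∈ Lag X y c φ i
      · exact Or.inl hx2
      · right
        rw [mem_Lag_iff] at hx2
        push Not at hx2
        obtain ⟨k, hk⟩ := hx2 hx.1
        have hki : k ≠ i := by
          rintro rfl
          exact lt_irrefl _ hk
        simp only [Set.mem_iUnion]
        refine ⟨k, by simpa using hki, hx.1, ?_⟩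
        have e1 := hx.2 k
        have e2 := abs_le.1 (abs_apply_le_norm (ψ - φ) i)
        have e3 := abs_le.1 (abs_apply_le_norm (ψ - φ) k)
        simp only [PiLp.sub_apply] at e2 e3
        rw [Set.mem_ofPred_eq, abs_le]
        constructor <;> linarith [e2.1, e2.2, e3.1, e3.2]
    have h1 : μ.real (Lag X y c ψ i) ≤ μ.real (Lag X y c φ i) +
        ∑ k ∈ Finset.univ.erase i, C * (2 * ‖ψ - φ‖) := by
      refine (measureReal_mono hsub).trans ((measureReal_union_le _ _).trans ?_)
      gcongr
      refine (measureReal_biUnion_finset_le _ _).trans (Finset.sum_le_sum fun k hk => ?_)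
      exact hslab k i (Finset.ne_of_mem_erase hk) _ _ (by positivity)
    have h2 : ∑ k ∈ Finset.univ.erase i, C * (2 * ‖ψ - φ‖) ≤ N * (C * (2 * ‖ψ - φ‖)) := by
      rw [Finset.sum_const, nsmul_eq_mul]
      gcongr
      exact (Finset.card_le_univ _).trans (by simp)
    simp only [G]
    linarith
  calc ‖G X y c μ ψ - G X y c μ φ‖ ≤ ∑ i, |(G X y c μ ψ - G X y c μ φ) i| := norm_le_sum_abs _
    _ ≤ ∑ i : Fin N, 2 * N * C * ‖ψ - φ‖ := by
        refine Finset.sum_le_sum fun i _ => ?_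
        rw [PiLp.sub_apply, abs_le]
        have e1 := hone ψ φ hpos i
        have e2 := hone φ ψ (by rwa [norm_sub_rev]) i
        rw [norm_sub_rev φ ψ] at e2
        constructor <;> linarith
    _ = 2 * N * C * N * ‖ψ - φ‖ := by
        simp only [Finset.sum_const, Finset.card_univ, Fintype.card_fin, nsmul_eq_mul]
        ring

end Laguerre

/-! ### Flows on a finite set that only climb. -/

section Flow

variable {ι : Type*} [Fintype ι] [DecidableEq ι] {f : ι → ι → ℝ} {d : ι → ℝ}

/-- The flow across an upper set, for a flow that moves strictly upwards. -/
theorem sum_upper_sub_eq_flow (hz : ∀ i k, i ≠ k → ¬ d i < d k → f i k = 0) {Q : Finset ι}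
    (hQ : ∀ i ∈ Q, ∀ k, d i < d k → k ∈ Q) :
    ∑ k ∈ Q, (∑ i, f i k - ∑ i, f k i) = ∑ i ∈ Qᶜ, ∑ k ∈ Q, f i k := by
  rw [Finset.sum_sub_distrib]
  have h1 : ∑ k ∈ Q, ∑ i, f i k = ∑ k ∈ Q, ∑ i ∈ Q, f i k + ∑ k ∈ Q, ∑ i ∈ Qᶜ, f i k := by
    rw [← Finset.sum_add_distrib]
    exact Finset.sum_congr rfl fun k _ => (Finset.sum_add_sum_compl Q _).symm
  -- Nothing leaves an upper set.
  have h2 : ∑ k ∈ Q, ∑ i, f k i = ∑ k ∈ Q, ∑ i ∈ Q, f k i := by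
    refine Finset.sum_congr rfl fun k hk => ?_
    rw [← Finset.sum_add_sum_compl Q, add_eq_left]
    refine Finset.sum_eq_zero fun i hi => hz k i ?_ fun hlt => ?_
    · rintro rfl
      exact (Finset.mem_compl.1 hi) hk
    · exact (Finset.mem_compl.1 hi) (hQ k hk i hlt)
  rw [h1, h2, Finset.sum_comm (s := Q) (t := Q), Finset.sum_comm (s := Qᶜ)]
  ring

/-- Whatever reaches `k` from elsewhere starts strictly below `d k`, hence crosses into the upper
set `Q` of indices with `d` at least `d k`. The total crossing is the net gain of `Q`. -/
theorem sum_flow_into_le (hf : ∀ i k, 0 ≤ f i k)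
    (hz : ∀ i k, i ≠ k → ¬ d i < d k → f i k = 0) (k : ι) :
    ∑ i ∈ Finset.univ.erase k, f i k ≤ ∑ j, |∑ i, f j i - ∑ i, f i j| := by
  classical
  set Q : Finset ι := Finset.univ.filter fun j => d k ≤ d j with hQ
  have hcut := sum_upper_sub_eq_flow hz (Q := Q) (fun i hi j hij => by
    simp only [hQ, Finset.mem_filter, Finset.mem_univ, true_and] at hi ⊢
    linarith)
  have hkQ : k ∈ Q := by simp [hQ]
  calc ∑ i ∈ Finset.univ.erase k, f i k ≤ ∑ i ∈ Qᶜ, f i k := by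
        rw [← Finset.sum_subset (s₁ := Qᶜ) (s₂ := Finset.univ.erase k)]
        · intro i hi
          simp only [Finset.mem_erase, Finset.mem_univ, and_true]
          rintro rfl
          exact (Finset.mem_compl.1 hi) hkQ
        · intro i hi hiQ
          refine hz i k (Finset.ne_of_mem_erase hi) ?_
          simpa [hQ] using hiQ
    _ ≤ ∑ i ∈ Qᶜ, ∑ j ∈ Q, f i j :=
        Finset.sum_le_sum fun i _ => Finset.single_le_sum (fun j _ => hf i j) hkQ
    _ = ∑ j ∈ Q, (∑ i, f i j - ∑ i, f j i) := hcut.symm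
    _ ≤ ∑ j ∈ Q, |∑ i, f j i - ∑ i, f i j| :=
        Finset.sum_le_sum fun j _ => by
          rw [abs_sub_comm]
          exact le_abs_self _
    _ ≤ ∑ j, |∑ i, f j i - ∑ i, f i j| :=
        Finset.sum_le_sum_of_subset_of_nonneg (Finset.subset_univ _) fun _ _ _ => abs_nonneg _

/-- Comparison principle for a flow that moves strictly upwards. -/
theorem sum_max_sub_le_of_flow (hf : ∀ i k, 0 ≤ f i k)
    (hz : ∀ i k, i ≠ k → ¬ d i < d k → f i k = 0) {γ : ι → ℝ} (hγ : ∀ i, 0 ≤ γ i)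
    (hneg : ∀ i, d i < 0 → ∑ k, f i k - ∑ k, f k i ≤ γ i)
    (hpos : ∀ i, 0 < d i → ∑ k, f k i - ∑ k, f i k ≤ γ i) :
    ∑ i, max (∑ k, f i k - ∑ k, f k i) 0 ≤ ∑ i, γ i := by
  classical
  -- Indices outside `Q` lose at most `γ` plus what they send into `Q`; this crossing flow is also
  -- the net gain of `Q`, and it cancels when the two bounds are added.
  set Q : Finset ι := Finset.univ.filter fun j => 0 < d j with hQ
  have hcut := sum_upper_sub_eq_flow hz (Q := Q) (fun i hi j hij => by
    simp only [hQ, Finset.mem_filter, Finset.mem_univ, true_and] at hi ⊢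
    linarith)
  have hlow : ∀ i ∈ Qᶜ, max (∑ k, f i k - ∑ k, f k i) 0 ≤ γ i + ∑ k ∈ Q, f i k := by
    intro i hi
    have hi0 : d i ≤ 0 := by simpa [hQ] using hi
    have hs : 0 ≤ ∑ k ∈ Q, f i k := Finset.sum_nonneg fun k _ => hf i k
    refine max_le ?_ (add_nonneg (hγ i) hs)
    rcases hi0.lt_or_eq with hlt | heq
    · linarith [hneg i hlt]
    -- At level 0 neither one-sided bound applies, but whatever leaves `i` enters `Q`.
    · have h1 : ∑ k, f i k ≤ f i i + ∑ k ∈ Q, f i k := by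
        have hiQ : i ∉ Q := Finset.mem_compl.1 hi
        rw [← Finset.sum_insert hiQ]
        refine le_of_eq (Finset.sum_subset (Finset.subset_univ _) fun k _ hk => ?_).symm
        simp only [Finset.mem_insert, not_or] at hk
        refine hz i k (Ne.symm hk.1) ?_
        rw [heq]
        simpa [hQ] using hk.2
      have h2 : f i i ≤ ∑ k, f k i :=
        Finset.single_le_sum (f := fun k => f k i) (fun k _ => hf k i) (Finset.mem_univ i)
      linarith [hγ i]
  have hup : ∀ i ∈ Q, max (∑ k, f i k - ∑ k, f k i) 0 ≤
      γ i - (∑ k, f k i - ∑ k, f i k) := by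
    intro i hi
    have := hpos i (by simpa [hQ] using hi)
    exact max_le (by linarith [hγ i]) (by linarith)
  rw [← Finset.sum_add_sum_compl Q, ← Finset.sum_add_sum_compl Q γ]
  have e1 := Finset.sum_le_sum hup
  have e2 := Finset.sum_le_sum hlow
  rw [Finset.sum_sub_distrib, hcut] at e1
  rw [Finset.sum_add_distrib] at e2
  linarith

end Flow

/-! ### The flow of mass between the cells of two price vectors. -/

section Cells

variable {n N : ℕ} {X : Set (Euc n)} {y : Fin N → Euc n} {c : Euc n → Euc n → ℝ}
  {μ : Measure (Euc n)}

theorem Setting.measurableSet_Lag (h : Setting X y c μ) (ψ : Euc N) (i : Fin N) :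
    MeasurableSet (Lag X y c ψ i) := by
  have h1 : Lag X y c ψ i = X ∩ ⋂ k, {x | X.indicator (fun x => c x (y i)) x + ψ i ≤
      X.indicator (fun x => c x (y k)) x + ψ k} := by
    ext x
    rw [mem_Lag_iff]
    simp only [Set.mem_inter_iff, Set.mem_iInter, Set.mem_ofPred_eq]
    refine and_congr_right fun hx => ?_
    simp only [Set.indicator_of_mem hx]
  rw [h1]
  exact h.measurableSet.inter (MeasurableSet.iInter fun k => measurableSet_le
    ((h.measurable_indicator i).add_const _) ((h.measurable_indicator k).add_const _))

theorem exists_mem_Lag [Nonempty (Fin N)] (ψ : Euc N) {x : Euc n} (hx : x ∈ X) :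
    ∃ i, x ∈ Lag X y c ψ i := by
  obtain ⟨i, hi⟩ := Finite.exists_min fun i => c x (y i) + ψ i
  exact ⟨i, mem_Lag_iff.2 ⟨hx, hi⟩⟩

theorem Lag_subset (ψ : Euc N) (i : Fin N) : Lag X y c ψ i ⊆ X := fun _ hx => hx.1

theorem Setting.measure_Lag_inter_eq_zero (h : Setting X y c μ) (ψ : Euc N) {i k : Fin N}
    (hik : i ≠ k) : μ (Lag X y c ψ i ∩ Lag X y c ψ k) = 0 := by
  refine measure_mono_null ?_ (h.measure_tie_eq_zero hik (ψ k - ψ i))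
  rintro x ⟨h1, h2⟩
  rw [mem_Lag_iff] at h1 h2
  refine ⟨h1.1, ?_⟩
  have e1 := h1.2 k
  have e2 := h2.2 i
  rw [Set.mem_ofPred_eq]
  linarith

theorem Setting.sum_measureReal_inter_Lag [Nonempty (Fin N)] (h : Setting X y c μ) (ψ : Euc N)
    {S : Set (Euc n)} (hS : MeasurableSet S) (hSX : S ⊆ X) :
    ∑ i, μ.real (S ∩ Lag X y c ψ i) = μ.real S := by
  have := h.prob
  have hcov : S = ⋃ i, S ∩ Lag X y c ψ i := by
    rw [← Set.inter_iUnion, Set.left_eq_inter]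
    exact fun x hx => Set.mem_iUnion.2 (exists_mem_Lag ψ (hSX hx))
  have h1 : μ S = ∑ i, μ (S ∩ Lag X y c ψ i) := by
    conv_lhs => rw [hcov]
    rw [measure_iUnion₀ _ fun i => (hS.inter (h.measurableSet_Lag ψ i)).nullMeasurableSet,
      tsum_fintype]
    intro i k hik
    exact measure_mono_null (Set.inter_subset_inter Set.inter_subset_right
      Set.inter_subset_right) (h.measure_Lag_inter_eq_zero ψ hik)
  rw [measureReal_def, h1, ENNReal.toReal_sum fun i _ => measure_ne_top _ _]
  rfl

theorem Setting.measureReal_eq_one (h : Setting X y c μ) : μ.real X = 1 := by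
  have := h.prob
  have h1 : μ X = 1 := by
    rw [← prob_compl_eq_zero_iff h.measurableSet]
    exact h.support
  simp [measureReal_def, h1]

theorem Setting.sum_G [Nonempty (Fin N)] (h : Setting X y c μ) (ψ : Euc N) :
    ∑ i, G X y c μ ψ i = 1 := by
  rw [← h.measureReal_eq_one, ← h.sum_measureReal_inter_Lag ψ h.measurableSet subset_rfl]
  refine Finset.sum_congr rfl fun i _ => ?_
  rw [Set.inter_eq_right.2 (Lag_subset ψ i)]
  rfl

theorem G_nonneg (ψ : Euc N) (i : Fin N) : 0 ≤ G X y c μ ψ i := measureReal_nonneg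

theorem Setting.G_le_one (h : Setting X y c μ) (ψ : Euc N) (i : Fin N) : G X y c μ ψ i ≤ 1 := by
  have := h.prob
  exact measureReal_le_one

/-- Mass only moves from a cell to one whose price has dropped relatively to its own. -/
theorem Setting.measureReal_Lag_inter_eq_zero (h : Setting X y c μ) (ψ φ : Euc N) {i k : Fin N}
    (hik : i ≠ k) (hd : ¬ ψ i - φ i < ψ k - φ k) :
    μ.real (Lag X y c ψ i ∩ Lag X y c φ k) = 0 := by
  have : μ (Lag X y c ψ i ∩ Lag X y c φ k) = 0 := by
    -- Membership gives `φ k - φ i ≤ c x (y i) - c x (y k) ≤ ψ k - ψ i`; `hd` reverses the outer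
    -- inequality, so equality holds and `x` is a tie.
    refine measure_mono_null ?_ (h.measure_tie_eq_zero hik (ψ k - ψ i))
    rintro x ⟨h1, h2⟩
    rw [mem_Lag_iff] at h1 h2
    refine ⟨h1.1, ?_⟩
    have e1 := h1.2 k
    have e2 := h2.2 i
    rw [Set.mem_ofPred_eq]
    linarith
  simp [measureReal_def, this]

theorem Setting.sum_right_flow [Nonempty (Fin N)] (h : Setting X y c μ) (ψ φ : Euc N)
    (i : Fin N) : ∑ k, μ.real (Lag X y c ψ i ∩ Lag X y c φ k) = G X y c μ ψ i :=
  h.sum_measureReal_inter_Lag φ (h.measurableSet_Lag ψ i) (Lag_subset ψ i)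

theorem Setting.sum_left_flow [Nonempty (Fin N)] (h : Setting X y c μ) (ψ φ : Euc N)
    (k : Fin N) : ∑ i, μ.real (Lag X y c ψ i ∩ Lag X y c φ k) = G X y c μ φ k := by
  simp_rw [Set.inter_comm (Lag X y c ψ _)]
  exact h.sum_right_flow φ ψ k

/-- Each half of a symmetric difference is an inflow from the other cells, for `ψ` to `φ` or for `φ`
to `ψ`, and `sum_flow_into_le` bounds it. Two halves for each of `N` cells give `2 * N`. -/
theorem Setting.symmDist_Lag_le [Nonempty (Fin N)] (h : Setting X y c μ) (ψ φ : Euc N) :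
    ∑ i, symmDist μ (Lag X y c ψ i) (Lag X y c φ i) ≤
      2 * N * norm1 (G X y c μ ψ - G X y c μ φ) := by
  classical
  have := h.prob
  have hdiff : ∀ ψ φ : Euc N, ∀ k, μ.real (Lag X y c φ k \ Lag X y c ψ k) ≤
      norm1 (G X y c μ ψ - G X y c μ φ) := by
    intro ψ φ k
    have hflow := sum_flow_into_le (f := fun i k => μ.real (Lag X y c ψ i ∩ Lag X y c φ k))
      (d := fun i => ψ i - φ i) (fun i k => measureReal_nonneg)
      (fun i k hik hd => h.measureReal_Lag_inter_eq_zero ψ φ hik hd) k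
    simp only [h.sum_right_flow ψ φ, h.sum_left_flow ψ φ] at hflow
    refine le_trans ?_ hflow
    refine le_trans (measureReal_mono ?_ (measure_ne_top _ _)) (measureReal_biUnion_finset_le _ _)
    rintro x ⟨h1, h2⟩
    obtain ⟨i, hi⟩ := exists_mem_Lag (y := y) (c := c) ψ h1.1
    refine Set.mem_iUnion₂.2 ⟨i, ?_, hi, h1⟩
    simp only [Finset.mem_erase, Finset.mem_univ, and_true]
    rintro rfl
    exact h2 hi
  have hsymm : norm1 (G X y c μ φ - G X y c μ ψ) = norm1 (G X y c μ ψ - G X y c μ φ) := by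
    simp only [norm1, PiLp.sub_apply]
    exact Finset.sum_congr rfl fun i _ => abs_sub_comm _ _
  calc ∑ i, symmDist μ (Lag X y c ψ i) (Lag X y c φ i)
      ≤ ∑ i : Fin N, (norm1 (G X y c μ ψ - G X y c μ φ) + norm1 (G X y c μ ψ - G X y c μ φ)) := by
        refine Finset.sum_le_sum fun i _ => (measureReal_union_le _ _).trans ?_
        refine add_le_add ?_ (hdiff ψ φ i)
        rw [← hsymm]
        exact hdiff φ ψ i
    _ = _ := by
        simp only [Finset.sum_const, Finset.card_univ, Fintype.card_fin, nsmul_eq_mul]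
        ring

/-- The comparison principle for the flow between cells. Both mass vectors sum to 1, so their `ℓ¹`
distance is twice the sum of the positive parts. -/
theorem Setting.norm1_G_sub_le [Nonempty (Fin N)] (h : Setting X y c μ) (ψ φ : Euc N)
    {γ : Fin N → ℝ} (hγ : ∀ i, 0 ≤ γ i)
    (hneg : ∀ i, ψ i < φ i → G X y c μ ψ i - G X y c μ φ i ≤ γ i)
    (hpos : ∀ i, φ i < ψ i → G X y c μ φ i - G X y c μ ψ i ≤ γ i) :
    norm1 (G X y c μ ψ - G X y c μ φ) ≤ 2 * ∑ i, γ i := by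
  classical
  have hflow := sum_max_sub_le_of_flow (f := fun i k => μ.real (Lag X y c ψ i ∩ Lag X y c φ k))
    (d := fun i => ψ i - φ i) (fun i k => measureReal_nonneg)
    (fun i k hik hd => h.measureReal_Lag_inter_eq_zero ψ φ hik hd) hγ
    (fun i hi => by
      rw [h.sum_right_flow ψ φ, h.sum_left_flow ψ φ]
      exact hneg i (by linarith))
    (fun i hi => by
      rw [h.sum_right_flow ψ φ, h.sum_left_flow ψ φ]
      exact hpos i (by linarith))
  simp only [h.sum_right_flow ψ φ, h.sum_left_flow ψ φ] at hflow
  have habs : norm1 (G X y c μ ψ - G X y c μ φ) =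
      2 * ∑ i, max (G X y c μ ψ i - G X y c μ φ i) 0
        - (∑ i, G X y c μ ψ i - ∑ i, G X y c μ φ i) := by
    rw [norm1, Finset.mul_sum, ← Finset.sum_sub_distrib, ← Finset.sum_sub_distrib]
    refine Finset.sum_congr rfl fun i _ => ?_
    rw [PiLp.sub_apply]
    rcases le_total (G X y c μ ψ i - G X y c μ φ i) 0 with h0 | h0
    · rw [max_eq_right h0, abs_of_nonpos h0]
      ring
    · rw [max_eq_left h0, abs_of_nonneg h0]
      ring
  rw [habs, h.sum_G, h.sum_G]
  linarith

end Cells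

/-! ### The dual problem and optimal prices. -/

section Potential

variable {n N : ℕ} {X : Set (Euc n)} {y : Fin N → Euc n} {c : Euc n → Euc n → ℝ}
  {μ : Measure (Euc n)}

theorem neg_sub_le_cStar (φ : Euc N) (x : Euc n) (k : Fin N) :
    -c x (y k) - φ k ≤ cStar y c φ x :=
  le_ciSup (f := fun i => -c x (y i) - φ i) (Set.finite_range _).bddAbove k

theorem cStar_eq_of_mem_Lag {φ : Euc N} {x : Euc n} {i : Fin N} (hx : x ∈ Lag X y c φ i) :
    cStar y c φ x = -c x (y i) - φ i := hx.2.symm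

theorem cStar_le_add [Nonempty (Fin N)] (φ φ' : Euc N) (x : Euc n) :
    cStar y c φ x ≤ cStar y c φ' x + ‖φ - φ'‖ := by
  refine ciSup_le fun k => ?_
  have h1 := neg_sub_le_cStar (y := y) (c := c) φ' x k
  have h2 := abs_le.1 (abs_apply_le_norm (φ - φ') k)
  rw [PiLp.sub_apply] at h2
  linarith [h2.1]

theorem Setting.exists_cost_bound (h : Setting X y c μ) :
    ∃ C : ℝ, 0 ≤ C ∧ ∀ i, ∀ x ∈ X, |c x (y i)| ≤ C := by
  choose C hC using fun i => h.compact.exists_bound_of_continuousOn (h.continuousOn i)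
  refine ⟨∑ i, |C i|, Finset.sum_nonneg fun _ _ => abs_nonneg _, fun i x hx => ?_⟩
  calc |c x (y i)| ≤ C i := hC i x hx
    _ ≤ |C i| := le_abs_self _
    _ ≤ _ := Finset.single_le_sum (f := fun i => |C i|) (fun _ _ => abs_nonneg _)
      (Finset.mem_univ i)

theorem Setting.integrableOn_cost (h : Setting X y c μ) (i : Fin N) :
    IntegrableOn (fun x => c x (y i)) X μ := by
  have := h.prob
  exact (h.continuousOn i).integrableOn_compact h.compact

theorem Setting.integrableOn_cStar [Nonempty (Fin N)] (h : Setting X y c μ) (φ : Euc N) :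
    IntegrableOn (cStar y c φ) X μ := by
  have := h.prob
  obtain ⟨C, hC, hb⟩ := h.exists_cost_bound
  have hm : AEStronglyMeasurable (cStar y c φ) (μ.restrict X) := by
    refine AEMeasurable.aestronglyMeasurable ?_
    exact AEMeasurable.iSup fun i =>
      ((h.integrableOn_cost i).aestronglyMeasurable.aemeasurable.neg.sub_const (φ i))
  refine Integrable.of_bound hm (C + ‖φ‖) ?_
  rw [ae_restrict_iff' h.measurableSet]
  refine Filter.Eventually.of_forall fun x hx => ?_
  obtain ⟨i, hi⟩ := exists_mem_Lag (y := y) (c := c) φ hx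
  rw [cStar_eq_of_mem_Lag hi]
  refine (norm_sub_le _ _).trans ?_
  rw [norm_neg, Real.norm_eq_abs, Real.norm_eq_abs]
  exact add_le_add (hb i x hx) (abs_apply_le_norm φ i)

/-- The dual objective for capacities `w`, as a function to be minimized. -/
noncomputable def dualObjective (X : Set (Euc n)) (y : Fin N → Euc n) (c : Euc n → Euc n → ℝ)
    (μ : Measure (Euc n)) (w φ : Euc N) : ℝ :=
  ∫ x in X, cStar y c φ x ∂μ + ∑ i, φ i * w i

theorem Setting.continuous_dualObjective [Nonempty (Fin N)] (h : Setting X y c μ) (w : Euc N) :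
    Continuous (dualObjective X y c μ w) := by
  have := h.prob
  refine Continuous.add ?_ (by fun_prop)
  have hle : ∀ φ φ' : Euc N, ∫ x in X, cStar y c φ x ∂μ ≤
      ∫ x in X, cStar y c φ' x ∂μ + ‖φ - φ'‖ := by
    intro φ φ'
    have hc : IntegrableOn (fun _ : Euc n => ‖φ - φ'‖) X μ := integrableOn_const (measure_ne_top _ _)
    have h1 := setIntegral_mono (μ := μ) (s := X) (h.integrableOn_cStar φ)
      ((h.integrableOn_cStar φ').add hc) (fun x => cStar_le_add φ φ' x)
    refine h1.trans (le_of_eq ?_)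
    simp only [Pi.add_apply]
    rw [integral_add (h.integrableOn_cStar φ') hc, setIntegral_const, h.measureReal_eq_one]
    simp
  refine (LipschitzWith.of_dist_le_mul (K := 1) fun φ φ' => ?_).continuous
  rw [Real.dist_eq, dist_eq_norm, NNReal.coe_one, one_mul, abs_le]
  have e1 := hle φ φ'
  have e2 := hle φ' φ
  rw [norm_sub_rev] at e2
  constructor <;> linarith

/-- Convexity along one coordinate, with the slope taken at the new point `φ'`: on its cell `i`,
`cStar φ'` is at most `cStar φ - s`, and on its other cells at most `cStar φ`. -/
theorem Setting.dualObjective_add_single_le [Nonempty (Fin N)] (h : Setting X y c μ)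
    (w φ : Euc N) (i : Fin N) (s : ℝ) :
    dualObjective X y c μ w (φ + s • EuclideanSpace.single i 1) ≤ dualObjective X y c μ w φ +
      s * (w i - G X y c μ (φ + s • EuclideanSpace.single i 1) i) := by
  classical
  have := h.prob
  set φ' : Euc N := φ + s • EuclideanSpace.single i 1 with hφ'
  have hi : φ' i = φ i + s := by simp [hφ']
  have hk : ∀ k, k ≠ i → φ' k = φ k := fun k hk => by simp [hφ', hk]
  have hL := h.measurableSet_Lag φ' i
  have hLi : IntegrableOn ((Lag X y c φ' i).indicator fun _ => s) X μ :=
    IntegrableOn.indicator (integrableOn_const (measure_ne_top _ _)) hL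
  have hpt : ∀ x ∈ X, cStar y c φ' x ≤
      (cStar y c φ - (Lag X y c φ' i).indicator fun _ => s) x := by
    intro x hx
    rw [Pi.sub_apply]
    by_cases hxi : x ∈ Lag X y c φ' i
    · rw [cStar_eq_of_mem_Lag hxi, Set.indicator_of_mem hxi, hi]
      linarith [neg_sub_le_cStar (y := y) (c := c) φ x i]
    · obtain ⟨k, hxk⟩ := exists_mem_Lag (y := y) (c := c) φ' hx
      have hki : k ≠ i := by
        rintro rfl
        exact hxi hxk
      rw [cStar_eq_of_mem_Lag hxk, Set.indicator_of_notMem hxi, hk k hki, sub_zero]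
      exact neg_sub_le_cStar φ x k
  have h1 := setIntegral_mono_on (h.integrableOn_cStar φ') ((h.integrableOn_cStar φ).sub hLi)
    h.measurableSet hpt
  simp only [Pi.sub_apply] at h1
  rw [integral_sub (h.integrableOn_cStar φ) hLi, setIntegral_indicator hL, setIntegral_const,
    Set.inter_eq_right.2 (Lag_subset φ' i), smul_eq_mul] at h1
  have h2 : ∑ k, φ' k * w k = ∑ k, φ k * w k + s * w i := by
    rw [← Finset.add_sum_erase _ _ (Finset.mem_univ i),
      ← Finset.add_sum_erase _ (fun k => φ k * w k) (Finset.mem_univ i), hi,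
      Finset.sum_congr rfl fun k hk' => by rw [hk k (Finset.ne_of_mem_erase hk')]]
    ring
  have h3 : G X y c μ φ' i = μ.real (Lag X y c φ' i) := rfl
  simp only [dualObjective]
  rw [h2, h3]
  linarith

theorem le_of_forall_le_add_mul {a b L r : ℝ} (hr : 0 < r)
    (hab : ∀ s, 0 < s → s ≤ r → a ≤ b + L * s) : a ≤ b := by
  have hlim : Filter.Tendsto (fun s : ℝ => b + L * s) (nhdsWithin 0 (Set.Ioi 0)) (nhds b) := by
    have h1 : Continuous fun s : ℝ => b + L * s := by fun_prop
    have h2 := h1.tendsto 0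
    simp only [mul_zero, add_zero] at h2
    exact h2.mono_left nhdsWithin_le_nhds
  refine ge_of_tendsto hlim ?_
  filter_upwards [self_mem_nhdsWithin, mem_nhdsWithin_of_mem_nhds (Iio_mem_nhds hr)]
    with s hs hsr
  exact hab s hs (le_of_lt hsr)

/-- Existence of optimal prices for the capacities `w`. -/
theorem Setting.exists_price [Nonempty (Fin N)] (h : Setting X y c μ) {L : ℝ}
    (hG : GLipschitz X y c μ L) {w : Euc N}
    (hw0 : ∀ i, 0 ≤ w i) (hw : 1 ≤ ∑ i, w i) :
    ∃ φ : Euc N, (∀ i, 0 ≤ φ i) ∧ (∀ i, G X y c μ φ i ≤ w i) ∧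
      ∀ i, 0 < φ i → G X y c μ φ i = w i := by
  classical
  obtain ⟨C, hC, hb⟩ := h.exists_cost_bound
  -- With this ceiling, a cell of price `R` is empty as soon as some other price is below 1.
  set R : ℝ := 2 * C + 1 with hR
  have hR0 : 0 < R := by positivity
  let box : Set (Euc N) := WithLp.ofLp ⁻¹' Set.Icc (fun _ => 0) (fun _ => R)
  have hbox : IsCompact box :=
    (PiLp.homeomorph 2 fun _ : Fin N => ℝ).isClosedEmbedding.isCompact_preimage isCompact_Icc
  have hmem : ∀ φ : Euc N, φ ∈ box ↔ ∀ i, 0 ≤ φ i ∧ φ i ≤ R := fun φ => by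
    simp only [box, Set.mem_preimage, Set.mem_Icc, Pi.le_def]
    exact forall_and.symm
  have hne : box.Nonempty := ⟨0, (hmem 0).2 fun i => ⟨le_rfl, hR0.le⟩⟩
  obtain ⟨φ, hφ, hmin⟩ := hbox.exists_isMinOn hne (h.continuous_dualObjective w).continuousOn
  rw [hmem] at hφ
  have hvar : ∀ i s, 0 ≤ φ i + s → φ i + s ≤ R →
      0 ≤ s * (w i - G X y c μ (φ + s • EuclideanSpace.single i 1) i) := by
    intro i s h0 h1
    have hin : φ + s • EuclideanSpace.single i (1 : ℝ) ∈ box := by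
      rw [hmem]
      intro k
      by_cases hk : k = i
      · subst hk
        simpa using ⟨h0, h1⟩
      · simpa [hk] using hφ k
    have e1 : dualObjective X y c μ w φ ≤ _ := hmin hin
    have e2 := h.dualObjective_add_single_le w φ i s
    linarith
  have hclose : ∀ i s, |G X y c μ (φ + s • EuclideanSpace.single i 1) i - G X y c μ φ i| ≤
      L * |s| := by
    intro i s
    have := hG (φ + s • EuclideanSpace.single i 1) φ
    rw [add_sub_cancel_left, norm_smul, PiLp.norm_single, norm_one, mul_one,
      Real.norm_eq_abs] at this
    exact (abs_apply_le_norm (G X y c μ _ - G X y c μ φ) i).trans this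
  -- First-order conditions: a positive price may be lowered and, in `hle`, a price below `R`
  -- raised. The slopes at the perturbed points converge by `hclose`.
  have hge : ∀ i, 0 < φ i → w i ≤ G X y c μ φ i := by
    intro i hi
    refine le_of_forall_le_add_mul (L := L) hi fun s hs hsi => ?_
    have e1 := hvar i (-s) (by linarith) (by linarith [(hφ i).2])
    have e2 := abs_le.1 (hclose i (-s))
    rw [abs_neg, abs_of_pos hs] at e2
    have e3 : w i - G X y c μ (φ + (-s) • EuclideanSpace.single i 1) i ≤ 0 := by
      by_contra hcon
      push Not at hcon
      nlinarith
    linarith [e2.2]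
  have hle : ∀ i, φ i < R → G X y c μ φ i ≤ w i := by
    intro i hi
    refine le_of_forall_le_add_mul (L := L) (sub_pos.2 hi) fun s hs hsi => ?_
    have e1 := hvar i s (by linarith [(hφ i).1]) (by linarith)
    have e2 := abs_le.1 (hclose i s)
    rw [abs_of_pos hs] at e2
    have e3 := nonneg_of_mul_nonneg_right e1 hs
    linarith [e2.1]
  have hall : ∀ i, G X y c μ φ i ≤ w i := by
    intro i
    rcases (hφ i).2.lt_or_eq with hlt | heq
    · exact hle i hlt
    by_cases hex : ∃ k, φ k < 1
    · obtain ⟨k, hk⟩ := hex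
      have hempty : Lag X y c φ i = ∅ := by
        rw [Set.eq_empty_iff_forall_notMem]
        intro x hx
        rw [mem_Lag_iff] at hx
        have e1 := hx.2 k
        have e2 := (abs_le.1 (hb i x hx.1)).1
        have e3 := (abs_le.1 (hb k x hx.1)).2
        linarith
      have hGi : G X y c μ φ i = 0 := by simp [G, hempty]
      rw [hGi]
      exact hw0 i
    -- All prices are positive, so `w ≤ G φ` coordinatewise; since `∑ w ≥ 1 = ∑ G φ`, equality holds
    -- throughout.
    · push Not at hex
      have hge' : ∀ k ∈ Finset.univ, w k ≤ G X y c μ φ k := fun k _ =>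
        hge k (by linarith [hex k])
      have hsum : ∑ k, w k = ∑ k, G X y c μ φ k :=
        le_antisymm (Finset.sum_le_sum hge') (by rw [h.sum_G]; exact hw)
      exact ((Finset.sum_eq_sum_iff_of_le hge').1 hsum i (Finset.mem_univ i)).ge
  exact ⟨φ, fun i => (hφ i).1, hall, fun i hi => le_antisymm (hall i) (hge i hi)⟩

end Potential

/-! ### Identification of minimizers with the cells of optimal prices. -/

section Minimizer

variable {n N : ℕ} {X : Set (Euc n)} {y : Fin N → Euc n} {c : Euc n → Euc n → ℝ}
  {μ : Measure (Euc n)}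

theorem Setting.injective (h : Setting X y c μ) : Function.Injective y := by
  have hX : X.Nonempty := by
    rw [Set.nonempty_iff_ne_empty]
    rintro rfl
    simpa using h.measureReal_eq_one
  obtain ⟨x, hx⟩ := hX
  intro i k hik
  by_contra hne
  exact h.twist x hx i k hne (by rw [hik])

/-- Points of `X` sent by `T` to `y_i`. -/
def fiber (X : Set (Euc n)) (y : Fin N → Euc n) (T : Euc n → Euc n) (i : Fin N) : Set (Euc n) :=
  X ∩ T ⁻¹' {y i}

theorem fiber_subset (T : Euc n → Euc n) (i : Fin N) : fiber X y T i ⊆ X := Set.inter_subset_left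

theorem Setting.measurableSet_fiber (h : Setting X y c μ) {T : Euc n → Euc n}
    (hT : Measurable T) (i : Fin N) : MeasurableSet (fiber X y T i) :=
  h.measurableSet.inter (hT (measurableSet_singleton _))

/-- A measurable selection of the cells. -/
theorem Setting.exists_selection [Nonempty (Fin N)] (h : Setting X y c μ) (φ : Euc N) :
    ∃ T : Euc n → Euc n, Measurable T ∧ (∀ x ∈ X, ∃ i, T x = y i ∧ x ∈ Lag X y c φ i) := by
  classical
  let D : Fin N → Set (Euc n) := fun i => Lag X y c φ i \ ⋃ k, ⋃ (_ : k < i), Lag X y c φ k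
  have hD : ∀ i, MeasurableSet (D i) := fun i => (h.measurableSet_Lag φ i).diff
    (MeasurableSet.iUnion fun k => MeasurableSet.iUnion fun _ => h.measurableSet_Lag φ k)
  have hlt : ∀ i k, i < k → Disjoint (D i) (D k) := by
    intro i k hik
    rw [Set.disjoint_left]
    intro x hi hk
    exact hk.2 (Set.mem_iUnion₂.2 ⟨i, hik, hi.1⟩)
  obtain ⟨T, hT, hTD⟩ := exists_measurable_piecewise D hD (fun i _ => y i)
    (fun i => measurable_const) (fun i k hik x hx => by
      rcases lt_or_gt_of_ne hik with hlt' | hlt'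
      · exact absurd hx.2 (Set.disjoint_left.1 (hlt i k hlt') hx.1)
      · exact absurd hx.1 (Set.disjoint_left.1 (hlt k i hlt') hx.2))
  refine ⟨T, hT, fun x hx => ?_⟩
  obtain ⟨i, hi, hmin⟩ := wellFounded_lt.has_min {i | x ∈ Lag X y c φ i} (exists_mem_Lag φ hx)
  refine ⟨i, hTD i ⟨hi, ?_⟩, hi⟩
  simp only [Set.mem_iUnion, not_exists]
  exact fun k hki hk => hmin k hk hki

theorem Setting.ae_mem (h : Setting X y c μ) : ∀ᵐ x ∂μ, x ∈ X := by
  rw [ae_iff]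
  exact h.support

theorem Setting.ae_not_mem_two_cells (h : Setting X y c μ) (φ : Euc N) :
    ∀ᵐ x ∂μ, ∀ i k, i ≠ k → ¬ (x ∈ Lag X y c φ i ∧ x ∈ Lag X y c φ k) := by
  rw [ae_all_iff]
  intro i
  rw [ae_all_iff]
  intro k
  by_cases hik : i = k
  · simp [hik]
  · have := h.measure_Lag_inter_eq_zero φ hik
    rw [measure_eq_zero_iff_ae_notMem] at this
    filter_upwards [this] with x hx _ using hx

/-- A map with values in the cells has the cells as its fibres. -/
theorem Setting.fiber_ae_eq_Lag (h : Setting X y c μ) {φ : Euc N} {T : Euc n → Euc n}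
    (hT : ∀ᵐ x ∂μ, ∃ i, T x = y i ∧ x ∈ Lag X y c φ i) (i : Fin N) :
    fiber X y T i =ᵐ[μ] Lag X y c φ i := by
  filter_upwards [hT, h.ae_not_mem_two_cells φ, h.ae_mem] with x hx htie hxX
  obtain ⟨k, hk, hxk⟩ := hx
  apply propext
  constructor
  · intro hfi
    have : k = i := h.injective (hk.symm.trans hfi.2)
    exact this ▸ hxk
  · intro hxi
    by_cases hki : k = i
    · exact ⟨hxX, by rw [← hki]; exact hk⟩
    · exact absurd ⟨hxk, hxi⟩ (htie k i hki)

theorem Setting.map_eq_sum_dirac (h : Setting X y c μ) {T : Euc n → Euc n} (hT : Measurable T)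
    (hTX : ∀ x ∈ X, T x ∈ Set.range y) :
    μ.map T = ∑ i, ENNReal.ofReal (μ.real (fiber X y T i)) • Measure.dirac (y i) := by
  classical
  have := h.prob
  ext S hS
  rw [Measure.map_apply hT hS, Measure.coe_finsetSum, Finset.sum_apply]
  have hcov : (T ⁻¹' S : Set (Euc n)) =ᵐ[μ] ⋃ i, (fiber X y T i ∩ T ⁻¹' S) := by
    filter_upwards [h.ae_mem] with x hx
    apply propext
    constructor
    · intro hxS
      obtain ⟨i, hi⟩ := hTX x hx
      exact Set.mem_iUnion.2 ⟨i, ⟨hx, hi.symm⟩, hxS⟩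
    · intro hxU
      obtain ⟨i, hi⟩ := Set.mem_iUnion.1 hxU
      exact hi.2
  rw [measure_congr hcov, measure_iUnion _
    (fun i => (h.measurableSet_fiber hT i).inter (hT hS)), tsum_fintype]
  · refine Finset.sum_congr rfl fun i _ => ?_
    rw [Measure.smul_apply, Measure.dirac_apply' _ hS, smul_eq_mul, measureReal_def,
      ENNReal.ofReal_toReal (measure_ne_top _ _)]
    by_cases hi : y i ∈ S
    · rw [Set.indicator_of_mem hi, Pi.one_apply, mul_one, Set.inter_eq_left.2]
      intro x hx
      rw [Set.mem_preimage, show T x = y i from hx.2]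
      exact hi
    · have : fiber X y T i ∩ T ⁻¹' S = ∅ := by
        rw [Set.eq_empty_iff_forall_notMem]
        rintro x ⟨hx, hxS⟩
        rw [Set.mem_preimage, show T x = y i from hx.2] at hxS
        exact hi hxS
      rw [this, measure_empty, Set.indicator_of_notMem hi, mul_zero]
  · intro i k hik
    refine Set.disjoint_left.2 fun x hi hk => hik (h.injective ?_)
    rw [← show T x = y i from hi.1.2, show T x = y k from hk.1.2]

theorem IsCompetitor.measureReal_fiber (h : Setting X y c μ) {T : Euc n → Euc n} {lam : Euc N}
    (hc : IsCompetitor X y μ T lam) (i : Fin N) : μ.real (fiber X y T i) = lam i := by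
  classical
  have := h.prob
  have h1 : μ (fiber X y T i) = μ (T ⁻¹' {y i}) := by
    refine measure_congr ?_
    filter_upwards [h.ae_mem] with x hx
    exact propext ⟨fun hx' => hx'.2, fun hx' => ⟨hx, hx'⟩⟩
  rw [measureReal_def, h1, ← Measure.map_apply hc.measurable (measurableSet_singleton _), hc.map_eq,
    Measure.coe_finsetSum, Finset.sum_apply, Finset.sum_eq_single i]
  · simp [hc.nonneg i]
  · intro k _ hki
    have : y k ≠ y i := fun heq => hki (h.injective heq)
    simp [this]
  · simp

/-- The cost of a map, corrected by prices, decomposed along its fibres. -/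
theorem Setting.integral_cost_add (h : Setting X y c μ) (φ : Euc N) {T : Euc n → Euc n}
    (hT : Measurable T) (hTX : ∀ x ∈ X, T x ∈ Set.range y) :
    ∃ F : Euc n → ℝ, IntegrableOn F X μ ∧
      (∀ x ∈ X, ∀ i, T x = y i → F x = c x (y i) + φ i) ∧
      ∫ x in X, F x ∂μ = ∫ x in X, c x (T x) ∂μ + ∑ i, φ i * μ.real (fiber X y T i) := by
  classical
  have := h.prob
  have hfib := h.measurableSet_fiber hT
  have hsum : ∀ (a : Fin N → Euc n → ℝ), ∀ x ∈ X, ∀ i, T x = y i →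
      ∑ k, (fiber X y T k).indicator (a k) x = a i x := by
    intro a x hx i hi
    rw [Finset.sum_eq_single i]
    · exact Set.indicator_of_mem (show x ∈ fiber X y T i from ⟨hx, hi⟩) _
    · intro k _ hki
      refine Set.indicator_of_notMem (fun hk : x ∈ fiber X y T k => hki (h.injective ?_)) _
      exact (show T x = y k from hk.2).symm.trans hi
    · simp
  have hI1 : ∀ i, IntegrableOn ((fiber X y T i).indicator fun x => c x (y i)) X μ := fun i =>
    IntegrableOn.indicator (h.integrableOn_cost i) (hfib i)
  have hI2 : ∀ i, IntegrableOn ((fiber X y T i).indicator fun _ => φ i) X μ := fun i =>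
    IntegrableOn.indicator (integrableOn_const (measure_ne_top _ _)) (hfib i)
  have hF1 : IntegrableOn (fun x => ∑ i, (fiber X y T i).indicator (fun x => c x (y i)) x) X μ :=
    integrable_finsetSum _ fun i _ => hI1 i
  have hF2 : IntegrableOn (fun x => ∑ i, (fiber X y T i).indicator (fun _ => φ i) x) X μ :=
    integrable_finsetSum _ fun i _ => hI2 i
  refine ⟨fun x => ∑ i, (fiber X y T i).indicator (fun x => c x (y i)) x +
    ∑ i, (fiber X y T i).indicator (fun _ => φ i) x, hF1.add hF2, ?_, ?_⟩
  · intro x hx i hi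
    dsimp only
    rw [hsum _ x hx i hi, hsum _ x hx i hi]
  · rw [integral_add hF1 hF2]
    congr 1
    · refine setIntegral_congr_fun h.measurableSet fun x hx => ?_
      obtain ⟨i, hi⟩ := hTX x hx
      exact (hsum _ x hx i hi.symm).trans (by rw [hi])
    · rw [integral_finsetSum _ fun i _ => hI2 i]
      refine Finset.sum_congr rfl fun i _ => ?_
      rw [setIntegral_indicator (hfib i), setIntegral_const,
        Set.inter_eq_right.2 (fiber_subset T i), smul_eq_mul, mul_comm]

/-- The minimizer for the capacities `w` is given by the cells of optimal prices. -/
theorem Setting.ae_mem_Lag_of_isMinimizer [Nonempty (Fin N)] (h : Setting X y c μ)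
    {w φ lam : Euc N} {T : Euc n → Euc n} (hφ0 : ∀ i, 0 ≤ φ i)
    (hφw : ∀ i, G X y c μ φ i ≤ w i) (hφe : ∀ i, 0 < φ i → G X y c μ φ i = w i)
    (hmin : IsMinimizer X y c μ (capFee w) T lam) :
    (∀ i, 0 ≤ lam i ∧ lam i ≤ w i) ∧ ∀ᵐ x ∂μ, ∃ i, T x = y i ∧ x ∈ Lag X y c φ i := by
  classical
  have := h.prob
  obtain ⟨T', hT', hsel⟩ := h.exists_selection φ
  have hT'X : ∀ x ∈ X, T' x ∈ Set.range y := fun x hx => by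
    obtain ⟨i, hi, _⟩ := hsel x hx
    exact ⟨i, hi.symm⟩
  have hfib : ∀ i, μ.real (fiber X y T' i) = G X y c μ φ i := fun i =>
    measureReal_congr (h.fiber_ae_eq_Lag (by filter_upwards [h.ae_mem] with x hx using hsel x hx) i)
  have hcomp : IsCompetitor X y μ T' (G X y c μ φ) := by
    refine ⟨hT', hT'X, G_nonneg φ, ?_⟩
    rw [h.map_eq_sum_dirac hT' hT'X]
    simp only [hfib]
  have hle := hmin.le T' _ hcomp
  have hfee : capFee w (G X y c μ φ) = 0 := if_pos fun i => ⟨G_nonneg φ i, hφw i⟩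
  rw [totalCost, totalCost, hfee, add_zero] at hle
  have hbox : ∀ i, 0 ≤ lam i ∧ lam i ≤ w i := by
    by_contra hcon
    rw [capFee, if_neg hcon, EReal.coe_add_top, top_le_iff] at hle
    exact EReal.coe_ne_top _ hle
  refine ⟨hbox, ?_⟩
  rw [capFee, if_pos hbox, add_zero, EReal.coe_le_coe_iff] at hle
  have hTX := hmin.competitor.mapsTo
  obtain ⟨F, hF, hFv, hFi⟩ := h.integral_cost_add φ hmin.competitor.measurable hTX
  obtain ⟨F', hF', hFv', hFi'⟩ := h.integral_cost_add φ hT' hT'X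
  have hF'c : ∫ x in X, F' x ∂μ = ∫ x in X, -cStar y c φ x ∂μ := by
    refine setIntegral_congr_fun h.measurableSet fun x hx => ?_
    obtain ⟨i, hi, hxi⟩ := hsel x hx
    rw [hFv' x hx i hi, cStar_eq_of_mem_Lag hxi]
    ring
  -- Complementary slackness: the cells of `φ` fill every capacity with a positive price, so no
  -- admissible `lam` has a larger priced mass.
  have hprice : ∑ i, φ i * μ.real (fiber X y T i) ≤ ∑ i, φ i * μ.real (fiber X y T' i) := by
    refine Finset.sum_le_sum fun i _ => ?_
    rw [hmin.competitor.measureReal_fiber h, hfib]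
    rcases (hφ0 i).lt_or_eq with hlt | heq
    · rw [hφe i hlt]
      exact mul_le_mul_of_nonneg_left (hbox i).2 hlt.le
    · simp [← heq]
  -- The pointwise duality gap. Optimality of `T` makes its integral nonpositive, so it vanishes
  -- almost everywhere, and a zero gap means that `x` lies in the cell of its target.
  have hgap : ∀ x ∈ X, 0 ≤ F x + cStar y c φ x := by
    intro x hx
    obtain ⟨i, hi⟩ := hTX x hx
    rw [hFv x hx i hi.symm]
    linarith [neg_sub_le_cStar (y := y) (c := c) φ x i]
  have hgap0 : 0 ≤ᵐ[μ.restrict X] fun x => F x + cStar y c φ x := by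
    filter_upwards [ae_restrict_mem h.measurableSet] with x hx using hgap x hx
  have hint : ∫ x in X, (F x + cStar y c φ x) ∂μ = 0 := by
    refine le_antisymm ?_ (integral_nonneg_of_ae hgap0)
    rw [integral_add hF (h.integrableOn_cStar φ)]
    rw [integral_neg] at hF'c
    linarith
  have hzero := (integral_eq_zero_iff_of_nonneg_ae hgap0 (hF.add (h.integrableOn_cStar φ))).1 hint
  rw [Filter.EventuallyEq, ae_restrict_iff' h.measurableSet] at hzero
  filter_upwards [hzero, h.ae_mem] with x hx hxX
  obtain ⟨i, hi⟩ := hTX x hxX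
  refine ⟨i, hi.symm, hxX, ?_⟩
  have e1 := hx hxX
  rw [hFv x hxX i hi.symm, Pi.zero_apply] at e1
  linarith

end Minimizer

/-! ### Bounds for the function `g`. -/

theorem g_eq_one_add_sq (t : ℝ) : g t = 1 + (Real.sqrt (1 + t ^ 2) - t) ^ 2 := by
  have := Real.sq_sqrt (by positivity : 0 ≤ 1 + t ^ 2)
  rw [g]
  nlinarith

theorem one_le_g (t : ℝ) : 1 ≤ g t := by
  rw [g_eq_one_add_sq]
  linarith [sq_nonneg (Real.sqrt (1 + t ^ 2) - t)]

/-- With `r = √(1 + t²) - t` one has `g t = 1 + r²` and `r (r + 2t) = 1`, hence `r ≤ 1 / t` and `r²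
≤ h`. -/
theorem g_le_of_pos {t h : ℝ} (ht : 0 < t) (hth : 1 ≤ t ^ 2 * h) : g t ≤ 1 + h := by
  have hsq := Real.sq_sqrt (by positivity : 0 ≤ 1 + t ^ 2)
  have hr : t ≤ Real.sqrt (1 + t ^ 2) := Real.le_sqrt_of_sq_le (by linarith)
  rw [g_eq_one_add_sq]
  set r := Real.sqrt (1 + t ^ 2) - t with hrdef
  have hr0 : 0 ≤ r := sub_nonneg.2 hr
  have h1 : r * (r + 2 * t) = 1 := by
    rw [hrdef]
    linarith
  have h2 : r * t ≤ 1 := by nlinarith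
  have h3 : (r * t) ^ 2 ≤ 1 := pow_le_one₀ (by positivity) h2
  have hh : 0 ≤ h := by
    by_contra hcon
    push Not at hcon
    nlinarith [sq_nonneg t]
  have h4 : r ^ 2 ≤ h := by
    calc r ^ 2 = r ^ 2 * 1 := (mul_one _).symm
      _ ≤ r ^ 2 * (t ^ 2 * h) := by gcongr
      _ = (r * t) ^ 2 * h := by ring
      _ ≤ 1 * h := by gcongr
      _ = h := one_mul h
  linarith

theorem one_le_g_mul_of_neg {t h : ℝ} (ht : t < 0) (hh : 0 ≤ h) (hth : 1 ≤ t ^ 2 * h) :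
    1 ≤ g t * h := by
  rw [g_eq_one_add_sq]
  have h0 := Real.sqrt_nonneg (1 + t ^ 2)
  have h1 : t ^ 2 ≤ (Real.sqrt (1 + t ^ 2) - t) ^ 2 := by nlinarith
  have h2 : t ^ 2 * h ≤ (1 + (Real.sqrt (1 + t ^ 2) - t) ^ 2) * h := by
    gcongr
    linarith
  linarith

/-! ### Stability estimates with shrunk prices. -/

section Stability

variable {n N : ℕ} {X : Set (Euc n)} {y : Fin N → Euc n} {c : Euc n → Euc n → ℝ}
  {μ : Measure (Euc n)}

theorem norm1_nonneg (v : Euc N) : 0 ≤ norm1 v := Finset.sum_nonneg fun _ _ => abs_nonneg _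

theorem norm1_le_mul_norm (v : Euc N) : norm1 v ≤ N * ‖v‖ := by
  refine (Finset.sum_le_sum fun i _ => abs_apply_le_norm v i).trans ?_
  simp

/-- Prices shrunk towards zero by `s`. -/
noncomputable def softThreshold (s : ℝ) (ψ : Euc N) : Euc N :=
  WithLp.toLp 2 fun i => max (ψ i - s) 0 + min (ψ i + s) 0

theorem norm_softThreshold_sub_le {s : ℝ} (hs : 0 ≤ s) (ψ : Euc N) :
    ‖ψ - softThreshold s ψ‖ ≤ N * s := by
  refine (norm_le_sum_abs _).trans ?_
  have h1 : ∀ i ∈ Finset.univ, |(ψ - softThreshold s ψ) i| ≤ s := by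
    intro i _
    rw [PiLp.sub_apply, abs_le]
    change -s ≤ ψ i - (max (ψ i - s) 0 + min (ψ i + s) 0) ∧
      ψ i - (max (ψ i - s) 0 + min (ψ i + s) 0) ≤ s
    rcases le_total (ψ i - s) 0 with h1 | h1 <;> rcases le_total (ψ i + s) 0 with h2 | h2 <;>
      simp only [max_eq_right, max_eq_left, min_eq_left, min_eq_right, h1, h2] <;>
      constructor <;> linarith
  refine (Finset.sum_le_sum h1).trans ?_
  simp

theorem lt_of_softThreshold_pos {s : ℝ} {ψ : Euc N} {i : Fin N}
    (hi : 0 < softThreshold s ψ i) : s < ψ i := by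
  change 0 < max (ψ i - s) 0 + min (ψ i + s) 0 at hi
  have h1 : min (ψ i + s) 0 ≤ 0 := min_le_right _ _
  by_contra hcon
  push Not at hcon
  rw [max_eq_right (by linarith)] at hi
  linarith

theorem lt_of_softThreshold_neg {s : ℝ} {ψ : Euc N} {i : Fin N}
    (hi : softThreshold s ψ i < 0) : ψ i < -s := by
  change max (ψ i - s) 0 + min (ψ i + s) 0 < 0 at hi
  have h1 : 0 ≤ max (ψ i - s) 0 := le_max_right _ _
  by_contra hcon
  push Not at hcon
  rw [min_eq_right (by linarith)] at hi
  linarith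

/-- Stability of the cell masses for `h ≤ 1`, without reference to the transport map. -/
theorem Setting.norm1_sub_le_of_price [Nonempty (Fin N)] (hS : Setting X y c μ) {L : ℝ}
    (hL : 0 ≤ L) (hG : GLipschitz X y c μ L) {h ε : ℝ} (hh : 0 < h) (hh1 : h ≤ 1) (hε : 0 < ε)
    {w ψ φ : Euc N} (hw : ∀ i, 0 ≤ w i ∧ w i ≤ 1) (hψ : ψ ∈ K X y c μ ε)
    (hφ0 : ∀ i, 0 ≤ φ i) (hφw : ∀ i, G X y c μ φ i ≤ w i)
    (hφe : ∀ i, 0 < φ i → G X y c μ φ i = w i) :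
    norm1 (G X y c μ ψ - G X y c μ φ) ≤
      2 * (N * ε + norm1 (wMap X y c μ h ε ψ - w)) + 2 * N * h
        + 3 * (N * (L * (N * Real.sqrt h))) := by
  -- At `|ψ i| ≥ √h` the argument `t = ψ i / h` satisfies `t² h ≥ 1`, as the bounds for `g` require.
  set s := Real.sqrt h with hs
  have hs0 : 0 < s := Real.sqrt_pos.2 hh
  have hs2 : s ^ 2 = h := Real.sq_sqrt hh.le
  set ψ' := softThreshold s ψ with hψ'
  have herr : norm1 (G X y c μ ψ - G X y c μ ψ') ≤ N * (L * (N * s)) := by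
    refine (norm1_le_mul_norm _).trans ?_
    gcongr
    refine (hG ψ ψ').trans ?_
    gcongr
    exact norm_softThreshold_sub_le hs0.le ψ
  have hsq : ∀ t : ℝ, s ≤ |t| → 1 ≤ (t / h) ^ 2 * h := by
    intro t ht
    have h1 : s ^ 2 ≤ t ^ 2 := by
      rw [← sq_abs t]
      gcongr
    rw [div_pow, div_mul_eq_mul_div, le_div_iff₀ (by positivity)]
    nlinarith
  have hwt : ∀ i, wMap X y c μ h ε ψ i = (G X y c μ ψ i - ε) * g (ψ i / h) := fun i => rfl
  have hpos : ∀ i, 0 < G X y c μ ψ i - ε := fun i => sub_pos.2 (hψ i)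
  -- The last term of `γ` passes from the masses at `ψ'` to those at `ψ`, which enter `wMap`. It
  -- counts twice here and once in the triangle inequality, whence the factor 3.
  have hmain := hS.norm1_G_sub_le ψ' φ (γ := fun i => ε + |(wMap X y c μ h ε ψ - w) i| + h
      + |(G X y c μ ψ - G X y c μ ψ') i|) (fun i => by positivity)
    (fun i hi => by
      rw [PiLp.sub_apply, PiLp.sub_apply]
      have a1 := neg_abs_le (G X y c μ ψ i - G X y c μ ψ' i)
      have a2 := le_abs_self (wMap X y c μ h ε ψ i - w i)
      -- Either `φ i > 0` and the capacity is saturated, or `φ i = 0` and `ψ i < -s`, where `g * h ≥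
      -- 1` bounds `G ψ i - ε` by `h` plus the error in `w`.
      rcases (hφ0 i).lt_or_eq with hlt | heq
      · rw [hφe i hlt]
        have b1 : G X y c μ ψ i - ε ≤ wMap X y c μ h ε ψ i := by
          rw [hwt]
          exact le_mul_of_one_le_right (hpos i).le (one_le_g _)
        linarith
      · rw [← heq] at hi
        have hlt := lt_of_softThreshold_neg hi
        have hneg : ψ i < 0 := by linarith
        have hg := one_le_g_mul_of_neg (div_neg_of_neg_of_pos hneg hh) hh.le
          (hsq (ψ i) (by rw [abs_of_neg hneg]; linarith))
        have b1 : G X y c μ ψ i - ε ≤ wMap X y c μ h ε ψ i * h := by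
          rw [hwt, mul_assoc]
          exact le_mul_of_one_le_right (hpos i).le hg
        have b2 : wMap X y c μ h ε ψ i * h ≤ h + |wMap X y c μ h ε ψ i - w i| := by
          have c1 := (hw i).2
          have c2 := abs_nonneg (wMap X y c μ h ε ψ i - w i)
          nlinarith
        linarith [G_nonneg (X := X) (y := y) (c := c) (μ := μ) φ i])
    (fun i hi => by
      rw [PiLp.sub_apply, PiLp.sub_apply]
      have a1 := le_abs_self (G X y c μ ψ i - G X y c μ ψ' i)
      have a2 := neg_abs_le (wMap X y c μ h ε ψ i - w i)
      have hgt := lt_of_softThreshold_pos (lt_of_le_of_lt (hφ0 i) hi)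
      have hψpos : 0 < ψ i := hs0.trans hgt
      have hg := g_le_of_pos (div_pos hψpos hh)
        (hsq (ψ i) (by rw [abs_of_pos hψpos]; exact hgt.le))
      have b1 : wMap X y c μ h ε ψ i ≤ G X y c μ ψ i - ε + h := by
        rw [hwt]
        have c1 := mul_le_mul_of_nonneg_left hg (hpos i).le
        have c2 : G X y c μ ψ i - ε ≤ 1 := by linarith [hS.G_le_one ψ i]
        nlinarith
      linarith [hφw i])
  have hsum : ∑ i, (ε + |(wMap X y c μ h ε ψ - w) i| + h + |(G X y c μ ψ - G X y c μ ψ') i|) =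
      N * ε + norm1 (wMap X y c μ h ε ψ - w) + N * h + norm1 (G X y c μ ψ - G X y c μ ψ') := by
    simp only [Finset.sum_add_distrib, Finset.sum_const, Finset.card_univ, Fintype.card_fin,
      nsmul_eq_mul, norm1]
  rw [hsum] at hmain
  have htri : norm1 (G X y c μ ψ - G X y c μ φ) ≤
      norm1 (G X y c μ ψ - G X y c μ ψ') + norm1 (G X y c μ ψ' - G X y c μ φ) := by
    simp only [norm1]
    rw [← Finset.sum_add_distrib]
    exact Finset.sum_le_sum fun i _ => abs_sub_le _ _ _
  linarith

theorem Setting.norm1_G_sub_le_two [Nonempty (Fin N)] (h : Setting X y c μ) (ψ φ : Euc N) :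
    norm1 (G X y c μ ψ - G X y c μ φ) ≤ 2 := by
  calc norm1 (G X y c μ ψ - G X y c μ φ) ≤ ∑ i, (G X y c μ ψ i + G X y c μ φ i) := by
        refine Finset.sum_le_sum fun i _ => ?_
        rw [PiLp.sub_apply, abs_le]
        have e1 := G_nonneg (X := X) (y := y) (c := c) (μ := μ) ψ i
        have e2 := G_nonneg (X := X) (y := y) (c := c) (μ := μ) φ i
        constructor <;> linarith
    _ = 2 := by
        rw [Finset.sum_add_distrib, h.sum_G, h.sum_G]
        norm_num

/-- The stability estimates for the constant `(1 + Λ N² + Λ)²`. -/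
theorem Setting.stability (hS : Setting X y c μ) {Λ : ℝ} (hΛ : 0 ≤ Λ)
    (hG : GLipschitz X y c μ (Λ * N)) {h ε : ℝ} {w ψ : Euc N} {T : Euc n → Euc n} {lam : Euc N}
    (hh : 0 < h) (hε : 0 < ε) (hw1 : 1 ≤ ∑ i, w i) (hw : ∀ i, 0 ≤ w i ∧ w i ≤ 1)
    (hψ : ψ ∈ K X y c μ ε) (hmin : IsMinimizer X y c μ (capFee w) T lam) :
    norm1 (G X y c μ ψ - lam) ≤
        2 * (N * ε + norm1 (wMap X y c μ h ε ψ - w)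
          + 2 * N * Real.sqrt (2 * (1 + Λ * N ^ 2 + Λ) ^ 2 * h)) ∧
    ∑ i, symmDist μ (Lag X y c ψ i) (X ∩ T ⁻¹' {y i}) ≤
        8 * N * (N * ε + norm1 (wMap X y c μ h ε ψ - w)
          + 2 * N * Real.sqrt (2 * (1 + Λ * N ^ 2 + Λ) ^ 2 * h)) := by
  have := hS.prob
  have hN : 0 < N := by
    rcases Nat.eq_zero_or_pos N with rfl | hN
    · simp at hw1
      linarith
    · exact hN
  have hN1 : (1 : ℝ) ≤ N := by exact_mod_cast hN
  have : Nonempty (Fin N) := ⟨⟨0, hN⟩⟩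
  obtain ⟨φ, hφ0, hφw, hφe⟩ := hS.exists_price hG (fun i => (hw i).1) hw1
  obtain ⟨hbox, hae⟩ := hS.ae_mem_Lag_of_isMinimizer hφ0 hφw hφe hmin
  have hfib := hS.fiber_ae_eq_Lag hae
  have hlam : lam = G X y c μ φ := by
    ext i
    rw [← hmin.competitor.measureReal_fiber hS i]
    exact measureReal_congr (hfib i)
  have hsym : ∀ i, symmDist μ (Lag X y c ψ i) (X ∩ T ⁻¹' {y i}) =
      symmDist μ (Lag X y c ψ i) (Lag X y c φ i) := fun i =>
    measureReal_congr ((Filter.EventuallyEq.rfl.diff (hfib i)).union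
      ((hfib i).diff Filter.EventuallyEq.rfl))
  set r := Real.sqrt (2 * (1 + Λ * N ^ 2 + Λ) ^ 2 * h) with hr
  set D := norm1 (wMap X y c μ h ε ψ - w) with hD
  have hD0 : 0 ≤ D := norm1_nonneg _
  have hsh := Real.sqrt_nonneg h
  have hrh : (1 + Λ * N ^ 2 + Λ) * Real.sqrt h ≤ r := by
    apply Real.le_sqrt_of_sq_le
    rw [mul_pow, Real.sq_sqrt hh.le]
    have : 0 ≤ (1 + Λ * N ^ 2 + Λ) ^ 2 * h := by positivity
    linarith
  have hmass : norm1 (G X y c μ ψ - G X y c μ φ) ≤ 2 * (N * ε + D + 2 * N * r) := by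
    -- For `h ≥ 1` the right side is at least 2, which bounds the `ℓ¹` distance of any two mass
    -- vectors.
    rcases le_total h 1 with hh1 | hh1
    · have hkey := hS.norm1_sub_le_of_price (by positivity) hG hh hh1 hε hw hψ hφ0 hφw hφe
      have h1 : h ≤ Real.sqrt h := Real.le_sqrt_of_sq_le (by nlinarith)
      have h2 : 2 * N * h + 3 * (N * (Λ * N * (N * Real.sqrt h))) ≤ 4 * N * r := by
        calc 2 * N * h + 3 * (N * (Λ * N * (N * Real.sqrt h)))
            ≤ 4 * N * Real.sqrt h + 4 * (N * (Λ * N * (N * Real.sqrt h)))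
              + 4 * N * (Λ * Real.sqrt h) := by
              have e1 : (N : ℝ) * h ≤ N * Real.sqrt h := by gcongr
              have e2 : 0 ≤ (N : ℝ) * Real.sqrt h := by positivity
              have e3 : 0 ≤ N * (Λ * N * (N * Real.sqrt h)) := by positivity
              have e4 : 0 ≤ N * (Λ * Real.sqrt h) := by positivity
              linarith
          _ = 4 * N * ((1 + Λ * N ^ 2 + Λ) * Real.sqrt h) := by ring
          _ ≤ 4 * N * r := by gcongr
      linarith
    · have h1 : 1 ≤ Real.sqrt h := Real.one_le_sqrt.2 hh1
      have h2 : 1 ≤ r := by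
        refine le_trans ?_ hrh
        have : 0 ≤ Λ * N ^ 2 + Λ := by positivity
        nlinarith
      have h3 := hS.norm1_G_sub_le_two ψ φ
      have h4 : 1 ≤ N * r := one_le_mul_of_one_le_of_one_le hN1 h2
      have h5 : 0 ≤ N * ε := by positivity
      linarith
  refine ⟨by rw [hlam]; exact hmass, ?_⟩
  simp only [hsym]
  refine (hS.symmDist_Lag_le ψ φ).trans ?_
  have h0 : 0 ≤ N * ε + D + 2 * N * r := by positivity
  calc 2 * N * norm1 (G X y c μ ψ - G X y c μ φ)
      ≤ 2 * N * (2 * (N * ε + D + 2 * N * r)) := by gcongr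
    _ = 4 * (N * (N * ε + D + 2 * N * r)) := by ring
    _ ≤ 8 * (N * (N * ε + D + 2 * N * r)) := by
        have : 0 ≤ N * (N * ε + D + 2 * N * r) := by positivity
        linarith
    _ = _ := by ring

end Stability

end StorageOT

/-! ### Assembly of the two statements. -/

theorem theorem2p2 (n N : ℕ) (hn : 2 ≤ n) :
    -- a universal constant, for data with a bounded density
    (∀ M A B τ : ℝ, 0 < M → 0 < A → 0 < B → 0 < τ →
      ∃ CL : ℝ, 0 < CL ∧
        ∀ (X : Set (StorageOT.Euc n)) (y : Fin N → StorageOT.Euc n)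
          (c : StorageOT.Euc n → StorageOT.Euc n → ℝ)
          (μ : MeasureTheory.Measure (StorageOT.Euc n)),
          StorageOT.Setting X y c μ → StorageOT.DataBounds X y c μ M A B τ →
          StorageOT.GLipschitz X y c μ (CL * N) ∧
          ∀ (h ε : ℝ) (w ψ : StorageOT.Euc N) (T : StorageOT.Euc n → StorageOT.Euc n)
            (lam : StorageOT.Euc N),
            0 < h → 0 < ε → ε < 1 / (2 * (N : ℝ)) →
            1 ≤ ∑ i, w i → (∀ i, 0 ≤ w i ∧ w i ≤ 1) →
            ψ ∈ StorageOT.K X y c μ ε →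
            StorageOT.IsMinimizer X y c μ (StorageOT.capFee w) T lam →
            StorageOT.norm1 (StorageOT.G X y c μ ψ - lam) ≤
                2 * (N * ε + StorageOT.norm1 (StorageOT.wMap X y c μ h ε ψ - w)
                  + 2 * N * Real.sqrt (2 * CL * h)) ∧
            ∑ i, StorageOT.symmDist μ (StorageOT.Lag X y c ψ i) (X ∩ T ⁻¹' {y i}) ≤
                8 * N * (N * ε + StorageOT.norm1 (StorageOT.wMap X y c μ h ε ψ - w)
                  + 2 * N * Real.sqrt (2 * CL * h))) ∧
    -- arbitrary absolutely continuous measures: the constant depends only on `N` and on the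
    -- Lipschitz constant of `G`
    (∀ Λ : ℝ, 0 < Λ →
      ∃ CL : ℝ, 0 < CL ∧
        ∀ (X : Set (StorageOT.Euc n)) (y : Fin N → StorageOT.Euc n)
          (c : StorageOT.Euc n → StorageOT.Euc n → ℝ)
          (μ : MeasureTheory.Measure (StorageOT.Euc n)),
          StorageOT.Setting X y c μ → StorageOT.GLipschitz X y c μ (Λ * N) →
          ∀ (h ε : ℝ) (w ψ : StorageOT.Euc N) (T : StorageOT.Euc n → StorageOT.Euc n)
            (lam : StorageOT.Euc N),
            0 < h → 0 < ε → ε < 1 / (2 * (N : ℝ)) →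
            1 ≤ ∑ i, w i → (∀ i, 0 ≤ w i ∧ w i ≤ 1) →
            ψ ∈ StorageOT.K X y c μ ε →
            StorageOT.IsMinimizer X y c μ (StorageOT.capFee w) T lam →
            StorageOT.norm1 (StorageOT.G X y c μ ψ - lam) ≤
                2 * (N * ε + StorageOT.norm1 (StorageOT.wMap X y c μ h ε ψ - w)
                  + 2 * N * Real.sqrt (2 * CL * h)) ∧
            ∑ i, StorageOT.symmDist μ (StorageOT.Lag X y c ψ i) (X ∩ T ⁻¹' {y i}) ≤
                8 * N * (N * ε + StorageOT.norm1 (StorageOT.wMap X y c μ h ε ψ - w)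
                  + 2 * N * Real.sqrt (2 * CL * h))) := by
  refine ⟨fun M A B τ hM hA hB hτ => ?_, fun Λ hΛ => ?_⟩
  · obtain ⟨C, hC, hslab⟩ := StorageOT.exists_measure_slab_le hn N hM hA hB hτ
    set Λ : ℝ := 2 * N * C with hΛ
    have hΛ0 : 0 ≤ Λ := by positivity
    -- The square is undone by the root in the estimates; the constant also exceeds `Λ`, so it
    -- serves in the Lipschitz bound.
    refine ⟨(1 + Λ * N ^ 2 + Λ) ^ 2, by positivity, fun X y c μ hS hd => ?_⟩
    have hG := hS.gLipschitz_of_slab hC.le (hslab X y c μ hS hd)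
    refine ⟨fun ψ φ => (hG ψ φ).trans ?_, fun h ε w ψ T lam hh hε _ hw1 hw hψ hmin =>
      hS.stability hΛ0 hG hh hε hw1 hw hψ hmin⟩
    gcongr
    have : 0 ≤ Λ * N ^ 2 := by positivity
    nlinarith
  · exact ⟨(1 + Λ * N ^ 2 + Λ) ^ 2, by positivity,
      fun X y c μ hS hG h ε w ψ T lam hh hε _ hw1 hw hψ hmin =>
        hS.stability hΛ.le hG hh hε hw1 hw hψ hmin⟩
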